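/- Let $n\ge 1$. A monotone triangle with $n$ rows is a triangular array $(a_{i,j})_{1\le j\le i\le n}$ of integers such that $a_{i,j}\le a_{i-1,j}\le a_{i,j+1}$ and $a_{i,j}<a_{i,j+1}$ for all $i,j$ for which the entries are defined; its bottom row is $(a_{n,1},\dots,a_{n,n})$. It is strictly increasing in southeast direction if $a_{i-1,j}<a_{i,j+1}$ for all $i,j$. On $\mathbb{C}[k_1,\dots,k_n]$ let $E_{k_i}$ be the shift operator $k_i\mapsto k_i+1$ and $\Delta_{k_i}=E_{k_i}-\operatorname{id}$. All these operators commute, and products of operators are compositions. Extend $\sum_{i=a}^{b} f(i)$ to all $a,b\in\mathbb{Z}$ by $0$ if $b=a-1$ and by $-\sum_{i=b+1}^{a-1} f(i)$ if $b<a-1$. Define $\alpha(n;k_1,\dots,k_n)$ for all $(k_1,\dots,k_n)\in\mathbb{Z}^n$ by $\alpha(1;k_1)=1$ and $\alpha(n;k_1,\dots,k_n)=\sum_{(l_1,\dots,l_{n-1})}^{(k_1,\dots,k_n)}\alpha(n-1;l_1,\dots,l_{n-1})$, where $\sum_{(l_1)}^{(k_1,k_2)}A(l_1)=\sum_{l_1=k_1}^{k_2}A(l_1)$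 and, for $n>2$, $$\sum_{(l_1,\dots,l_{n-1})}^{(k_1,\dots,k_n)}A(l_1,\dots,l_{n-1})=\sum_{(l_1,\dots,l_{n-2})}^{(k_1,\dots,k_{n-1})}\ \sum_{l_{n-1}=k_{n-1}+1}^{k_n}A(l_1,\dots,l_{n-1})+\sum_{(l_1,\dots,l_{n-2})}^{(k_1,\dots,k_{n-2},k_{n-1}-1)}A(l_1,\dots,l_{n-2},k_{n-1}).$$ Theorem. (a) For all $1\le p<q\le n$ the operator $\operatorname{id}+E_{k_q}\Delta_{k_p}$ on $\mathbb{C}[k_1,\dots,k_n]$ is invertible. For all integers $k_1<k_2<\dots<k_n$ the number of monotone triangles with $n$ rows and bottom row $(k_1,\dots,k_n)$ is the value at $(k_1,\dots,k_n)$ of the polynomial $$\Bigl(\prod_{1\le p<q\le n}(\operatorname{id}+E_{k_q}\Delta_{k_p})^{-1}\Bigr)\prod_{1\le i<j\le n}\frac{k_j-k_i}{j-i},$$ and for all $(k_1,\dots,k_n)\in\mathbb{Z}^n$ the value of this polynomial is $\alpha(n;k_1,\dots,k_n)$. (b) Equivalently: there is exactly one polynomial in $\mathbb{C}[k_1,\dots,k_n]$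 whose value at every strictly increasing integer tuple is the number of monotone triangles with that bottom row; it agrees with $\alpha(n;\cdot)$ on all of $\mathbb{Z}^n$, and, writing $\alpha$ for this polynomial, $$\Bigl(\prod_{1\le p<q\le n}(\operatorname{id}+E_{k_q}\Delta_{k_p})\Bigr)\alpha=\prod_{1\le i<j\le n}\frac{k_j-k_i}{j-i}.$$ At every integer tuple $k_1<\dots<k_n$ the value of this image is the number of monotone triangles with bottom row $(k_1,\dots,k_n)$ that are strictly increasing in southeast direction. If moreover $k_1\ge 1$, this value is also the number of semistandard tableaux of shape $(k_n-n,k_{n-1}-(n-1),\dots,k_1-1)$ with entries in $\{1,\dots,n\}$. -/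

import Mathlib

/-! ### Operators on polynomials in `k_1, …, k_n` -/

namespace MonTri

open MvPolynomial

/-- The shift operator `E_{k_i}` on `ℂ[k_1, …, k_n]`: it replaces the variable `k_i` by `k_i + 1`
and leaves the other variables alone. -/
noncomputable def shift {n : ℕ} (i : Fin n) : Module.End ℂ (MvPolynomial (Fin n) ℂ) :=
  (aeval (fun j : Fin n =>
    if j = i then (X j + 1 : MvPolynomial (Fin n) ℂ) else X j)).toLinearMap

/-- The difference operator `Δ_{k_i} = E_{k_i} - id`. -/
noncomputable def diff {n : ℕ} (i : Fin n) : Module.End ℂ (MvPolynomial (Fin n) ℂ) :=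
  shift i - 1

/-- The operator `id + E_{k_q} Δ_{k_p}`, for the pair `x = (p, q)`. -/
noncomputable def factor {n : ℕ} (x : Fin n × Fin n) :
    Module.End ℂ (MvPolynomial (Fin n) ℂ) :=
  1 + shift x.2 * diff x.1

theorem shift_commute {n : ℕ} (i j : Fin n) : Commute (shift i) (shift j) := by
  have h : (aeval (fun l : Fin n =>
        if l = i then (X l + 1 : MvPolynomial (Fin n) ℂ) else X l)).comp
      (aeval (fun l : Fin n =>
        if l = j then (X l + 1 : MvPolynomial (Fin n) ℂ) else X l)) =
      (aeval (fun l : Fin n =>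
        if l = j then (X l + 1 : MvPolynomial (Fin n) ℂ) else X l)).comp
      (aeval (fun l : Fin n =>
        if l = i then (X l + 1 : MvPolynomial (Fin n) ℂ) else X l)) := by
    apply MvPolynomial.algHom_ext
    intro l
    by_cases hi : l = i <;> by_cases hj : l = j <;> simp [hi, hj] <;> split_ifs <;> simp_all
  apply LinearMap.ext
  intro P
  exact DFunLike.congr_fun h P

theorem factor_commute {n : ℕ} (x y : Fin n × Fin n) : Commute (factor x) (factor y) := by
  have hsd : ∀ i j : Fin n, Commute (shift i) (diff j) := fun i j =>
    (shift_commute i j).sub_right (Commute.one_right _)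
  have hdd : ∀ i j : Fin n, Commute (diff i) (diff j) := fun i j =>
    (hsd i j).sub_left (Commute.one_left _)
  have h : Commute (shift x.2 * diff x.1) (shift y.2 * diff y.1) :=
    ((shift_commute _ _).mul_right (hsd _ _)).mul_left ((hsd _ _).symm.mul_right (hdd _ _))
  exact (Commute.one_left _).add_left ((Commute.one_right _).add_right h)

/-- The pairs `(p, q)` with `p < q`. -/
def pairs (n : ℕ) : Finset (Fin n × Fin n) :=
  Finset.univ.filter (fun x => x.1 < x.2)

/-- The composition `∏_{p < q} (id + E_{k_q} Δ_{k_p})`. The factors commute, so the order of the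
composition does not matter. -/
noncomputable def prodOp (n : ℕ) : Module.End ℂ (MvPolynomial (Fin n) ℂ) :=
  (pairs n).noncommProd factor (fun x _ y _ _ => factor_commute x y)

/-- The composition `∏_{p < q} (id + E_{k_q} Δ_{k_p})⁻¹` of the inverses. (`Ring.inverse` is the
inverse of a unit, and `0` on non-units.) -/
noncomputable def prodInvOp (n : ℕ) : Module.End ℂ (MvPolynomial (Fin n) ℂ) :=
  (pairs n).noncommProd (fun x => Ring.inverse (factor x))
    (fun x _ y _ _ => (factor_commute x y).ringInverse_ringInverse)

/-- The polynomial `∏_{i < j} (k_j - k_i) / (j - i)`. -/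
noncomputable def vandermonde (n : ℕ) : MvPolynomial (Fin n) ℂ :=
  ∏ x ∈ pairs n, C (((x.2 : ℕ) : ℂ) - ((x.1 : ℕ) : ℂ))⁻¹ * (X x.2 - X x.1)

/-- The value of a polynomial at an integer point. -/
noncomputable def evalInt {n : ℕ} (k : Fin n → ℤ) (P : MvPolynomial (Fin n) ℂ) : ℂ :=
  eval (fun i => (k i : ℂ)) P

/-! ### Monotone triangles -/

/-- A monotone triangle with `n` rows: integers `a_{i,j}`, `1 ≤ j ≤ i ≤ n`, with
`a_{i+1,j} ≤ a_{i,j} ≤ a_{i+1,j+1}` and strictly increasing rows. The entry function is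
normalised to `0` outside the index range. -/
@[ext] structure MonotoneTriangle (n : ℕ) where
  entry : ℕ → ℕ → ℤ
  northeast : ∀ i j, 1 ≤ j → j ≤ i → i + 1 ≤ n → entry (i + 1) j ≤ entry i j
  southeast : ∀ i j, 1 ≤ j → j ≤ i → i + 1 ≤ n → entry i j ≤ entry (i + 1) (j + 1)
  row_strict : ∀ i j, 1 ≤ j → j + 1 ≤ i → i ≤ n → entry i j < entry i (j + 1)
  zeros : ∀ i j, ¬ (1 ≤ j ∧ j ≤ i ∧ i ≤ n) → entry i j = 0

/-- The bottom row of `t` is `k`; the `j`-th component of `k` has index `j - 1` in `Fin n`. -/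
def MonotoneTriangle.HasBottomRow {n : ℕ} (t : MonotoneTriangle n) (k : Fin n → ℤ) : Prop :=
  ∀ j : Fin n, t.entry n ((j : ℕ) + 1) = k j

/-- `t` is strictly increasing in southeast direction. -/
def MonotoneTriangle.StrictSoutheast {n : ℕ} (t : MonotoneTriangle n) : Prop :=
  ∀ i j, 1 ≤ j → j ≤ i → i + 1 ≤ n → t.entry i j < t.entry (i + 1) (j + 1)

/-- The number of monotone triangles with `n` rows and bottom row `k`. -/
noncomputable def countMT (n : ℕ) (k : Fin n → ℤ) : ℕ :=
  Nat.card {t : MonotoneTriangle n // t.HasBottomRow k}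

/-- The number of monotone triangles with `n` rows and bottom row `k` that are strictly
increasing in southeast direction. -/
noncomputable def countStrictMT (n : ℕ) (k : Fin n → ℤ) : ℕ :=
  Nat.card {t : MonotoneTriangle n // t.HasBottomRow k ∧ t.StrictSoutheast}

/-- The number of semistandard tableaux of shape `μ` with entries in a fixed `n`-element chain
(here `{0, …, n - 1}`). -/
noncomputable def countSSYT (n : ℕ) (μ : YoungDiagram) : ℕ :=
  Nat.card {T : SemistandardYoungTableau μ // ∀ i j, (i, j) ∈ μ → T i j < n}

/-! ### The extension of the counting function to all integer bottom rows -/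

/-- Extended summation `∑_{i=a}^{b} f(i)`: it is `0` for `b = a - 1`, and
`-f(b+1) - ⋯ - f(a-1)` for `b + 1 ≤ a - 1`. -/
noncomputable def extSum (a b : ℤ) (f : ℤ → ℤ) : ℤ :=
  if a ≤ b then ∑ i ∈ Finset.Icc a b, f i else - ∑ i ∈ Finset.Icc (b + 1) (a - 1), f i

/-- The extended summation operator `∑_{(l_1,…,l_n)}^{(k_1,…,k_{n+1})} A(l_1,…,l_n)`, by recursion
on the number of variables. For `k_1 < ⋯ < k_{n+1}` it is the sum over all integer tuples with
`k_1 ≤ l_1 ≤ k_2 ≤ ⋯ ≤ l_n ≤ k_{n+1}` and `l_i ≠ l_{i+1}`. -/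
noncomputable def rowSum : (n : ℕ) → (Fin (n + 1) → ℤ) → ((Fin n → ℤ) → ℤ) → ℤ
  | 0, _, A => A ![]
  | 1, k, A => extSum (k 0) (k 1) (fun l => A ![l])
  | n + 2, k, A =>
    -- `m` is the last but one entry of `k`
    let m : ℤ := k (Fin.last (n + 1)).castSucc
    rowSum (n + 1) (Fin.init k)
        (fun l => extSum (m + 1) (k (Fin.last (n + 2))) (fun x => A (Fin.snoc l x)))
      + rowSum (n + 1) (Function.update (Fin.init k) (Fin.last (n + 1)) (m - 1))
        (fun l => A (Fin.snoc l m))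

/-- The function `α(n; k_1, …, k_n)` on all of `ℤⁿ`. -/
noncomputable def alpha : (n : ℕ) → (Fin n → ℤ) → ℤ
  | 0, _ => 1
  | 1, _ => 1
  | n + 2, k => rowSum (n + 1) k (alpha (n + 1))

end MonTri

/-!
Functions on `ℤⁿ` form a module over `ℤ[x_1, …, x_n]` with `x_i` acting as the shift `E_{k_i}`.
On the functions annihilated by some power of every `x_i - 1` the symbol `1 + x_q (x_p - 1)` of
`id + E_{k_q} Δ_{k_p}` acts invertibly, by the geometric series, so it may be cancelled there.

If `A` solves `∏_{p < q} (id + E_{k_q} Δ_{k_p}) A = (∏_i Δ_{k_i}) C` with `C` antisymmetric, then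
the row sum `F` of `A` solves `∏_{p < q} (id + E_{k_q} Δ_{k_p}) F = (∏_i E_{k_i}) D`, where `D` is
the alternating sum of `C` over the omitted variable. For a row sum is determined by its difference
in the first variable, which is minus a row sum in one variable less, and by the fact that
`(id + E_{k_2} Δ_{k_1}) F` vanishes for `k_1 = k_2`; the solution of the second equation has the
same difference by induction, and the vanishing property by antisymmetry. For the determinants
`D = det (k_i choose j)` the recursion produces `α`, with the Vandermonde product as its image.

These determinants also count the triangles that are strictly increasing in southeast direction,
because they telescope in the sum over the next row; and such triangles are the chains of shapes
formed by the entries less than `i` of a semistandard tableau.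
-/

namespace MonTri

open MvPolynomial
open Matrix (vecCons)

/-! ### Functions on integer points as a module over the polynomial ring -/

/-- Translation of functions on `ℤ^σ` by vectors with nonnegative coordinates. -/
def translation (σ M : Type*) [AddCommGroup M] :
    Multiplicative (σ →₀ ℕ) →* Module.End ℤ ((σ → ℤ) → M) where
  toFun v := LinearMap.funLeft ℤ M fun k i => k i + v.toAdd i
  map_one' := by ext; simp
  map_mul' v w := by ext; simp [add_assoc]

/-- `ℤ[x_i : i ∈ σ]` acts on functions on `ℤ^σ`: the variable `x_i` shifts the `i`-th coordinate
by one, so that `E_{k_i}` and `Δ_{k_i}` become multiplication by `x_i` and `x_i - 1`. -/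
noncomputable abbrev shiftModule {σ M : Type*} [AddCommGroup M] :
    Module (MvPolynomial σ ℤ) ((σ → ℤ) → M) :=
  Module.compHom _ (AddMonoidAlgebra.lift ℤ _ _ (translation σ M)).toRingHom

attribute [local instance] shiftModule

section ShiftModule

variable {σ τ M N : Type*} [AddCommGroup M] [AddCommGroup N]

theorem monomial_smul_apply (s : σ →₀ ℕ) (a : ℤ) (f : (σ → ℤ) → M) (k : σ → ℤ) :
    (monomial s a • f) k = a • f fun i => k i + s i := by
  change AddMonoidAlgebra.lift ℤ _ _ (translation σ M) (AddMonoidAlgebra.single s a) f k = _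
  rw [AddMonoidAlgebra.lift_single]
  rfl

theorem X_smul_apply [DecidableEq σ] (i : σ) (f : (σ → ℤ) → M) (k : σ → ℤ) :
    ((X i : MvPolynomial σ ℤ) • f) k = f (Function.update k i (k i + 1)) := by
  rw [X, monomial_smul_apply, one_smul]
  congr 1
  ext j
  obtain rfl | h := eq_or_ne j i <;> simp [*]

theorem prod_X_smul_apply [Fintype σ] (f : (σ → ℤ) → M) (k : σ → ℤ) :
    ((∏ i, X i : MvPolynomial σ ℤ) • f) k = f fun i => k i + 1 := by
  classical
  have h : (∏ i, X i : MvPolynomial σ ℤ) = monomial (∑ i, Finsupp.single i 1) 1 := by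
    simp only [X, monomial_sum_one]
  rw [h, monomial_smul_apply, one_smul]
  simp [Finsupp.finsetSum_apply, Finsupp.single_apply]

theorem map_smul_of_map_X_smul {R S A B : Type*} [CommRing R] [CommRing S] [AddCommGroup A]
    [AddCommGroup B] [Module R A] [Module S B] {φ : MvPolynomial σ ℤ →+* R}
    {ψ : MvPolynomial σ ℤ →+* S} {T : A →+ B} (h : ∀ i a, T (φ (X i) • a) = ψ (X i) • T a)
    (p : MvPolynomial σ ℤ) (a : A) : T (φ p • a) = ψ p • T a := by
  induction p using MvPolynomial.induction_on generalizing a with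
  | C c =>
    rw [eq_intCast C c, map_intCast, map_intCast, Int.cast_smul_eq_zsmul, Int.cast_smul_eq_zsmul,
      map_zsmul]
  | add p q hp hq => simp only [map_add, add_smul, hp, hq]
  | mul_X p i hp => simp only [map_mul, mul_smul, hp, h]

/-- Pullback of functions along a map of index sets. -/
def pullback (g : σ → τ) : ((σ → ℤ) → M) →+ ((τ → ℤ) → M) where
  toFun f k := f (k ∘ g)
  map_zero' := rfl
  map_add' _ _ := rfl

@[simp] theorem pullback_apply (g : σ → τ) (f : (σ → ℤ) → M) (k : τ → ℤ) :
    pullback g f k = f (k ∘ g) := rfl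

theorem pullback_smul {g : σ → τ} (hg : g.Injective) (p : MvPolynomial σ ℤ) (f : (σ → ℤ) → M) :
    pullback g (p • f) = rename g p • pullback g f := by
  classical
  refine map_smul_of_map_X_smul (φ := RingHom.id _) (ψ := (rename g : _ →ₐ[ℤ] _).toRingHom)
    (fun i f => ?_) p f
  ext k
  simp only [RingHom.id_apply, AlgHom.toRingHom_eq_coe, RingHom.coe_coe, rename_X,
    X_smul_apply, pullback_apply, Function.update_comp_eq_of_injective k hg, Function.comp_apply]

theorem X_smul_pullback {g : σ → τ} {j : τ} (hj : j ∉ Set.range g) (f : (σ → ℤ) → M) :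
    (X j : MvPolynomial τ ℤ) • pullback g f = pullback g f := by
  classical
  ext k
  rw [X_smul_apply, pullback_apply, Function.update_comp_eq_of_notMem_range _ _ hj, pullback_apply]

theorem X_sub_one_smul_pullback {g : σ → τ} {j : τ} (hj : j ∉ Set.range g) (f : (σ → ℤ) → M) :
    (X j - 1 : MvPolynomial τ ℤ) • pullback g f = 0 := by
  rw [sub_smul, one_smul, X_smul_pullback hj, sub_self]

/-- Restriction of a function to the hyperplane where the first coordinate is `x`. -/
def slice {n : ℕ} (x : ℤ) : ((Fin (n + 1) → ℤ) → M) →+ ((Fin n → ℤ) → M) where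
  toFun f l := f (Matrix.vecCons x l)
  map_zero' := rfl
  map_add' _ _ := rfl

@[simp] theorem slice_apply {n : ℕ} (x : ℤ) (f : (Fin (n + 1) → ℤ) → M) (l : Fin n → ℤ) :
    slice x f l = f (Matrix.vecCons x l) := rfl

theorem slice_rename_succ_smul {n : ℕ} (x : ℤ) (p : MvPolynomial (Fin n) ℤ)
    (f : (Fin (n + 1) → ℤ) → M) : slice x (rename Fin.succ p • f) = p • slice x f := by
  refine map_smul_of_map_X_smul (φ := (rename Fin.succ : _ →ₐ[ℤ] _).toRingHom)
    (ψ := RingHom.id _) (fun i f => ?_) p f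
  ext l
  simp [X_smul_apply, Matrix.vecCons, Fin.cons_update]

theorem comp_smul (φ : M →+ N) (p : MvPolynomial σ ℤ) (f : (σ → ℤ) → M) :
    φ ∘ (p • f) = p • (φ ∘ f) := by
  classical
  refine map_smul_of_map_X_smul (φ := RingHom.id _) (ψ := RingHom.id _)
    (T := φ.compLeft (σ → ℤ)) (fun i f => ?_) p f
  ext k
  simp [X_smul_apply]

theorem isUnit_one_add_of_locally_nilpotent {R A : Type*} [Ring R] [AddCommGroup A] [Module R A]
    {u : Module.End R A} (hu : ∀ a, ∃ N : ℕ, (u ^ N) a = 0) : IsUnit (1 + u) := by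
  have hgeom (N : ℕ) : (∑ j ∈ Finset.range N, (-u) ^ j) * (1 + u) = 1 - (-u) ^ N := by
    simpa using geom_sum_mul_neg (-u) N
  have hpow (a : A) : ∃ N : ℕ, ((-u) ^ N) a = 0 := by
    obtain ⟨N, hN⟩ := hu a
    refine ⟨N, ?_⟩
    rw [neg_pow, Module.End.mul_apply, hN, map_zero]
  rw [Module.End.isUnit_iff]
  refine ⟨(injective_iff_map_eq_zero _).mpr fun a ha => ?_, fun a => ?_⟩
  · obtain ⟨N, hN⟩ := hpow a
    simpa [ha, hN] using (congr($(hgeom N) a)).symm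
  · obtain ⟨N, hN⟩ := hpow a
    have hcomm : Commute (∑ j ∈ Finset.range N, (-u) ^ j) (1 + u) :=
      Commute.sum_left _ _ _ fun j _ =>
        (Commute.one_right _).add_right ((Commute.refl u).neg_left.pow_left j)
    refine ⟨(∑ j ∈ Finset.range N, (-u) ^ j) a, ?_⟩
    rw [← Module.End.mul_apply, ← hcomm, hgeom, LinearMap.sub_apply, hN, sub_zero,
      Module.End.one_apply]

/-- The functions that are annihilated by some power of each difference operator; polynomials in
the coordinates are of this kind. -/
noncomputable def finiteDegree (σ M : Type*) [AddCommGroup M] :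
    Submodule (MvPolynomial σ ℤ) ((σ → ℤ) → M) :=
  ⨅ i, Submodule.torsion' _ _ (Submonoid.powers (X i - 1 : MvPolynomial σ ℤ))

theorem mem_finiteDegree {f : (σ → ℤ) → M} :
    f ∈ finiteDegree σ M ↔ ∀ i, ∃ N : ℕ, (X i - 1 : MvPolynomial σ ℤ) ^ N • f = 0 := by
  simp [finiteDegree, Submodule.mem_iInf, Submodule.mem_torsion'_iff, Submonoid.mem_powers_iff,
    Submonoid.smul_def]

theorem pullback_mem_finiteDegree {g : σ → τ} (hg : g.Injective) {f : (σ → ℤ) → M}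
    (hf : f ∈ finiteDegree σ M) : pullback g f ∈ finiteDegree τ M := by
  refine mem_finiteDegree.mpr fun j => ?_
  by_cases hj : j ∈ Set.range g
  · obtain ⟨i, rfl⟩ := hj
    obtain ⟨N, hN⟩ := mem_finiteDegree.mp hf i
    have h := pullback_smul hg ((X i - 1) ^ N) f
    rw [map_pow, map_sub, rename_X, map_one, hN, map_zero] at h
    exact ⟨N, h.symm⟩
  · exact ⟨1, by rw [pow_one, X_sub_one_smul_pullback hj]⟩

theorem slice_mem_finiteDegree {n : ℕ} {f : (Fin (n + 1) → ℤ) → M}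
    (hf : f ∈ finiteDegree (Fin (n + 1)) M) (x : ℤ) : slice x f ∈ finiteDegree (Fin n) M := by
  refine mem_finiteDegree.mpr fun i => ?_
  obtain ⟨N, hN⟩ := mem_finiteDegree.mp hf i.succ
  have h := slice_rename_succ_smul x ((X i - 1) ^ N) f
  rw [map_pow, map_sub, rename_X, map_one, hN, map_zero] at h
  exact ⟨N, h.symm⟩

/-- The polynomials that act invertibly on the functions of finite degree. -/
noncomputable def invertibleSymbols (σ M : Type*) [AddCommGroup M] :
    Submonoid (MvPolynomial σ ℤ) :=
  (IsUnit.submonoid _).comap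
    (algebraMap (MvPolynomial σ ℤ) (Module.End (MvPolynomial σ ℤ) (finiteDegree σ M)))

theorem bijective_smul_of_mem_invertibleSymbols {p : MvPolynomial σ ℤ}
    (hp : p ∈ invertibleSymbols σ M) :
    Function.Bijective fun f : finiteDegree σ M => p • f :=
  (Module.End.isUnit_iff _).mp hp

theorem eq_of_smul_eq_smul {p : MvPolynomial σ ℤ} (hp : p ∈ invertibleSymbols σ M)
    {f g : (σ → ℤ) → M} (hf : f ∈ finiteDegree σ M) (hg : g ∈ finiteDegree σ M)
    (h : p • f = p • g) : f = g :=
  congrArg Subtype.val ((bijective_smul_of_mem_invertibleSymbols hp).injective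
    (a₁ := ⟨f, hf⟩) (a₂ := ⟨g, hg⟩) (Subtype.ext h))

theorem exists_smul_eq {p : MvPolynomial σ ℤ} (hp : p ∈ invertibleSymbols σ M)
    {f : (σ → ℤ) → M} (hf : f ∈ finiteDegree σ M) : ∃ g ∈ finiteDegree σ M, p • g = f := by
  obtain ⟨g, hg⟩ := (bijective_smul_of_mem_invertibleSymbols hp).surjective ⟨f, hf⟩
  exact ⟨g, g.2, congrArg Subtype.val hg⟩

/-- The symbol of the operator `id + E_q Δ_p`. -/
noncomputable def symb (p q : σ) : MvPolynomial σ ℤ := 1 + X q * (X p - 1)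

theorem symb_mem_invertibleSymbols (p q : σ) : symb p q ∈ invertibleSymbols σ M := by
  change IsUnit (algebraMap (MvPolynomial σ ℤ)
    (Module.End (MvPolynomial σ ℤ) (finiteDegree σ M)) (1 + X q * (X p - 1)))
  rw [map_add, map_one]
  refine isUnit_one_add_of_locally_nilpotent fun f => ?_
  obtain ⟨N, hN⟩ := mem_finiteDegree.mp f.2 p
  replace hN : (X p - 1 : MvPolynomial σ ℤ) ^ N • f = 0 := Subtype.ext hN
  exact ⟨N, by rw [← map_pow, Module.algebraMap_end_apply, mul_pow, mul_smul, hN, smul_zero]⟩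

theorem rename_symb (g : σ → τ) (p q : σ) : rename g (symb p q) = symb (g p) (g q) := by
  simp [symb]

/-- The symbol of `∏_{p < q} (id + E_q Δ_p)`. -/
noncomputable def prodSymb (n : ℕ) : MvPolynomial (Fin n) ℤ := ∏ x ∈ pairs n, symb x.1 x.2

/-- The symbol of `∏_{q > 0} (id + E_q Δ_0)`. -/
noncomputable def symbZero (n : ℕ) : MvPolynomial (Fin (n + 1)) ℤ := ∏ q : Fin n, symb 0 q.succ

theorem prod_pairs_succ {R : Type*} [CommMonoid R] (n : ℕ) (F : Fin (n + 1) × Fin (n + 1) → R) :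
    ∏ x ∈ pairs (n + 1), F x =
      (∏ q : Fin n, F (0, q.succ)) * ∏ x ∈ pairs n, F (x.1.succ, x.2.succ) := by
  simp only [pairs, Finset.prod_filter, ← Finset.univ_product_univ, Finset.prod_product,
    Fin.prod_univ_succ, Fin.not_lt_zero, if_false, one_mul, Fin.succ_pos,
    if_true, Fin.succ_lt_succ_iff]

theorem prodSymb_succ (n : ℕ) :
    prodSymb (n + 1) = symbZero n * rename Fin.succ (prodSymb n) := by
  simp only [prodSymb, prod_pairs_succ, symbZero, map_prod, rename_symb]

theorem prodSymb_mem_invertibleSymbols (n : ℕ) : prodSymb n ∈ invertibleSymbols (Fin n) M :=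
  prod_mem fun _ _ => symb_mem_invertibleSymbols _ _

theorem symbZero_mem_invertibleSymbols (n : ℕ) :
    symbZero n ∈ invertibleSymbols (Fin (n + 1)) M :=
  prod_mem fun _ _ => symb_mem_invertibleSymbols _ _

theorem symbZero_succ_eq_rename_mul (m : ℕ) (i : Fin (m + 1)) :
    symbZero (m + 1) = rename i.succ.succAbove (symbZero m) * symb 0 i.succ := by
  rw [symbZero, Fin.prod_univ_succAbove _ i, mul_comm]
  simp only [symbZero, map_prod, rename_symb, Fin.succ_succAbove_zero, Fin.succ_succAbove_succ]

theorem rename_swap_succ_symbZero {m : ℕ} (i j : Fin m) :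
    rename (Equiv.swap i.succ j.succ) (symbZero m) = symbZero m := by
  have h0 : Equiv.swap i.succ j.succ 0 = 0 :=
    Equiv.swap_apply_of_ne_of_ne i.succ_ne_zero.symm j.succ_ne_zero.symm
  simp only [symbZero, map_prod, rename_symb, h0, ← (Fin.succ_injective m).map_swap]
  exact Equiv.prod_comp (Equiv.swap i j) fun q => symb 0 q.succ

theorem exists_prodSymb_eq_symb_mul (n : ℕ) :
    ∃ r, prodSymb (n + 2) = symb 0 1 * r ∧ rename (Equiv.swap 0 1) r = r := by
  have hsucc (q : Fin n) : Equiv.swap (0 : Fin (n + 2)) 1 q.succ.succ = q.succ.succ :=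
    Equiv.swap_apply_of_ne_of_ne (Fin.succ_ne_zero _) (by simp [Fin.ext_iff])
  refine ⟨(∏ q : Fin n, symb 0 q.succ.succ * symb 1 q.succ.succ) *
    rename (Fin.succ ∘ Fin.succ) (prodSymb n), ?_, ?_⟩
  · rw [prodSymb_succ, prodSymb_succ, symbZero, symbZero, Fin.prod_univ_succ]
    simp only [map_mul, map_prod, rename_symb, rename_rename, Finset.prod_mul_distrib,
      Fin.succ_zero_eq_one, mul_assoc]
  · simp only [map_mul, map_prod, rename_symb, rename_rename, hsucc, Equiv.swap_apply_left,
      Equiv.swap_apply_right]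
    exact congr($(Finset.prod_congr rfl fun q _ => mul_comm _ _) *
      rename $(funext hsucc) (prodSymb n))

end ShiftModule

/-! ### Row sums -/

theorem extSum_of_le {a b : ℤ} (h : a ≤ b + 1) (f : ℤ → ℤ) :
    extSum a b f = ∑ i ∈ Finset.Icc a b, f i := by
  obtain h | rfl := h.lt_or_eq
  · rw [extSum, if_pos (Int.lt_add_one_iff.mp h)]
  · simp [extSum]

theorem extSum_of_ge {a b : ℤ} (h : b + 1 ≤ a) (f : ℤ → ℤ) :
    extSum a b f = -∑ i ∈ Finset.Icc (b + 1) (a - 1), f i := by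
  rw [extSum, if_neg (by lia)]

theorem extSum_self_sub_one (a : ℤ) (f : ℤ → ℤ) : extSum a (a - 1) f = 0 := by
  simp [extSum]

theorem extSum_succ_left (a b : ℤ) (f : ℤ → ℤ) : extSum a b f = f a + extSum (a + 1) b f := by
  rcases le_or_gt a b with h | h
  · rw [extSum_of_le (by lia), extSum_of_le (by lia), ← Finset.insert_Icc_add_one_left_eq_Icc h,
      Finset.sum_insert (by simp)]
  · rw [extSum_of_ge (by lia), extSum_of_ge (by lia), add_sub_cancel_right,
      ← Finset.insert_Icc_sub_one_right_eq_Icc (Int.add_one_le_of_lt h),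
      Finset.sum_insert (by simp)]
    ring

theorem extSum_succ_right (a b : ℤ) (f : ℤ → ℤ) : extSum a b f = extSum a (b - 1) f + f b := by
  rcases le_or_gt a b with h | h
  · rw [extSum_of_le (by lia), extSum_of_le (by lia),
      ← Finset.insert_Icc_sub_one_right_eq_Icc h, Finset.sum_insert (by simp), add_comm]
  · rw [extSum_of_ge (by lia), extSum_of_ge (by lia), sub_add_cancel,
      ← Finset.insert_Icc_add_one_left_eq_Icc (Int.le_sub_one_of_lt h),
      Finset.sum_insert (by simp)]
    ring

theorem extSum_add (a b : ℤ) (f g : ℤ → ℤ) :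
    extSum a b (fun x => f x + g x) = extSum a b f + extSum a b g := by
  simp only [extSum, Finset.sum_add_distrib, neg_add]
  split_ifs <;> rfl

/-- The counterpart of `Matrix.vecCons` that appends a last entry. -/
abbrev vecSnoc {α : Type*} {n : ℕ} (l : Fin n → α) (x : α) : Fin (n + 1) → α :=
  Fin.snoc (α := fun _ => α) l x

theorem vecCons_vecSnoc {α : Type*} {n : ℕ} (x y : α) (l : Fin n → α) :
    vecCons x (vecSnoc l y) = vecSnoc (vecCons x l) y :=
  Fin.cons_snoc_eq_snoc_cons x l y

theorem rowSum_vecSnoc (n : ℕ) (K : Fin (n + 1) → ℤ) (m z : ℤ) (A : (Fin (n + 2) → ℤ) → ℤ) :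
    rowSum (n + 2) (vecSnoc (vecSnoc K m) z) A =
      rowSum (n + 1) (vecSnoc K m) (fun l => extSum (m + 1) z fun x => A (vecSnoc l x)) +
      rowSum (n + 1) (vecSnoc K (m - 1)) (fun l => A (vecSnoc l m)) := by
  rw [rowSum]
  simp [vecSnoc, Fin.update_snoc_last]

theorem rowSum_one (a b : ℤ) (A : (Fin 1 → ℤ) → ℤ) :
    rowSum 1 ![a, b] A = extSum a b fun x => A ![x] := rfl

theorem rowSum_two (a b c : ℤ) (A : (Fin 2 → ℤ) → ℤ) :
    rowSum 2 ![a, b, c] A =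
      extSum a b (fun x => extSum (b + 1) c fun y => A ![x, y]) +
      extSum a (b - 1) (fun x => A ![x, b]) := by
  have hsnoc (l : Fin 1 → ℤ) (x : ℤ) : vecSnoc l x = ![l 0, x] := by
    ext i; fin_cases i <;> rfl
  have habc : ![a, b, c] = vecSnoc (vecSnoc ![a] b) c := by ext i; fin_cases i <;> rfl
  rw [habc, rowSum_vecSnoc]
  simp only [hsnoc]
  rfl

theorem rowSum_vecCons (n : ℕ) (a b : ℤ) (K : Fin n → ℤ) (A : (Fin (n + 1) → ℤ) → ℤ) :
    rowSum (n + 1) (vecCons a (vecCons b K)) A =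
      extSum a (b - 1) (fun x => rowSum n (vecCons b K) (slice x A)) +
      rowSum n (vecCons (b + 1) K) (slice b A) := by
  induction n using Nat.twoStepInduction with
  | zero =>
    obtain rfl := Subsingleton.elim K ![]
    exact extSum_succ_right a b _
  | one =>
    obtain ⟨c, rfl⟩ : ∃ c, K = ![c] := ⟨K 0, by ext i; fin_cases i; rfl⟩
    refine (rowSum_two a b c A).trans ?_
    simp only [rowSum_one, slice_apply, extSum_succ_left b c, extSum_add]
    rw [extSum_succ_right a b]
    ring
  | more n _ ih =>
    obtain ⟨K, m, z, rfl⟩ : ∃ (K' : Fin n → ℤ) (m z : ℤ), K = vecSnoc (vecSnoc K' m) z :=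
      ⟨Fin.init (Fin.init K), Fin.init K (Fin.last _), K (Fin.last _), by simp [vecSnoc]⟩
    have hslice (x : ℤ) (l : Fin (n + 1) → ℤ) (y : ℤ) :
        slice x A (vecSnoc l y) = A (vecSnoc (vecCons x l) y) := by
      rw [slice_apply, vecCons_vecSnoc]
    simp only [vecCons_vecSnoc, rowSum_vecSnoc, extSum_add, hslice]
    simp only [← vecCons_vecSnoc, ih]
    simp only [slice, AddMonoidHom.coe_mk, ZeroHom.coe_mk, vecCons_vecSnoc]
    ring

theorem rowSum_vecCons_add_one (n : ℕ) (a : ℤ) (K : Fin (n + 1) → ℤ)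
    (A : (Fin (n + 1) → ℤ) → ℤ) :
    rowSum (n + 1) (vecCons (a + 1) K) A =
      rowSum (n + 1) (vecCons a K) A - rowSum n K (slice a A) := by
  obtain ⟨b, K, rfl⟩ : ∃ b K', K = vecCons b K' := ⟨_, _, (Matrix.cons_head_tail K).symm⟩
  rw [rowSum_vecCons, rowSum_vecCons, extSum_succ_left a]
  ring

theorem rowSum_diagonal (n : ℕ) (a : ℤ) (K : Fin n → ℤ) (A : (Fin (n + 1) → ℤ) → ℤ) :
    rowSum (n + 1) (vecCons a (vecCons a K)) A +
        rowSum (n + 1) (vecCons (a + 1) (vecCons (a + 1) K)) A =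
      rowSum (n + 1) (vecCons a (vecCons (a + 1) K)) A := by
  simp only [rowSum_vecCons, add_sub_cancel_right]
  rw [extSum_self_sub_one, extSum_succ_left a a]
  ring

theorem rowSum_eq_of_vecCons_add_one_of_diagonal {n : ℕ} {A : (Fin (n + 1) → ℤ) → ℤ}
    {F : (Fin (n + 2) → ℤ) → ℤ}
    (hdiff : ∀ a K, F (vecCons (a + 1) K) = F (vecCons a K) - rowSum n K (slice a A))
    (hdiag : ∀ a K, F (vecCons a (vecCons a K)) + F (vecCons (a + 1) (vecCons (a + 1) K)) =
      F (vecCons a (vecCons (a + 1) K))) (k : Fin (n + 2) → ℤ) :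
    rowSum (n + 1) k A = F k := by
  set D : (Fin (n + 2) → ℤ) → ℤ := fun k => rowSum (n + 1) k A - F k with hD
  have hperiodic (K) : Function.Periodic (fun a => D (vecCons a K)) 1 := fun a => by
    simp only [hD, rowSum_vecCons_add_one, hdiff]
    ring
  have hconst (a b : ℤ) (K) : D (vecCons a K) = D (vecCons b K) := by
    simpa using (hperiodic K).int_mul (a - b) b
  obtain ⟨a, b, K, rfl⟩ : ∃ a b K', k = vecCons a (vecCons b K') :=
    ⟨_, _, _, by rw [Matrix.cons_head_tail, Matrix.cons_head_tail]⟩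
  have hzero : D (vecCons b (vecCons b K)) + D (vecCons (b + 1) (vecCons (b + 1) K)) -
      D (vecCons b (vecCons (b + 1) K)) = 0 := by
    simp only [hD, ← rowSum_diagonal, ← hdiag]
    ring
  rw [hconst (b + 1) b, add_sub_cancel_right, hconst b a] at hzero
  exact sub_eq_zero.mp hzero

section AltSum

variable {M : Type*} [AddCommGroup M]

/-- The functions that change sign when two coordinates are exchanged. -/
def Antisymm {m : ℕ} (f : (Fin m → ℤ) → M) : Prop :=
  ∀ i j, i ≠ j → pullback (Equiv.swap i j) f = -f

/-- The alternating sum of the functions obtained by forgetting one coordinate. -/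
def altSum {m : ℕ} (f : (Fin m → ℤ) → M) : (Fin (m + 1) → ℤ) → M :=
  ∑ j : Fin (m + 1), (-1 : ℤ) ^ (j : ℕ) • pullback j.succAbove f

theorem altSum_apply {m : ℕ} (f : (Fin m → ℤ) → M) (k : Fin (m + 1) → ℤ) :
    altSum f k = ∑ j : Fin (m + 1), (-1 : ℤ) ^ (j : ℕ) • f (k ∘ j.succAbove) := by
  simp [altSum, Finset.sum_apply]

/-- The alternating sum of the functions obtained by forgetting one coordinate other than the
first. -/
def altSumTail {m : ℕ} (f : (Fin (m + 1) → ℤ) → M) : (Fin (m + 2) → ℤ) → M :=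
  ∑ i : Fin (m + 1), (-1 : ℤ) ^ (i : ℕ) • pullback i.succ.succAbove f

theorem slice_altSumTail {m : ℕ} (f : (Fin (m + 1) → ℤ) → M) (x : ℤ) :
    slice x (altSumTail f) = altSum (slice x f) := by
  ext l
  simp only [altSumTail, slice_apply, altSum_apply, Finset.sum_apply, Pi.smul_apply,
    pullback_apply]
  refine Finset.sum_congr rfl fun i _ => congrArg (_ • f ·) ?_
  ext q
  cases q using Fin.cases <;> simp

theorem altSumTail_mem_finiteDegree {m : ℕ} {f : (Fin (m + 1) → ℤ) → M}
    (hf : f ∈ finiteDegree (Fin (m + 1)) M) : altSumTail f ∈ finiteDegree (Fin (m + 2)) M :=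
  sum_mem fun _ _ => zsmul_mem (pullback_mem_finiteDegree Fin.succAbove_right_injective hf) _

theorem X_zero_sub_one_smul_altSum {m : ℕ} (f : (Fin (m + 1) → ℤ) → M) :
    (X 0 - 1 : MvPolynomial (Fin (m + 2)) ℤ) • altSum f =
      -altSumTail ((X 0 - 1 : MvPolynomial (Fin (m + 1)) ℤ) • f) := by
  have h0 : (0 : Fin (m + 2)) ∉ Set.range (Fin.succAbove 0) := by simp
  rw [altSum, Fin.sum_univ_succ, smul_add, smul_comm, X_sub_one_smul_pullback h0, smul_zero,
    zero_add, Finset.smul_sum, altSumTail, ← Finset.sum_neg_distrib]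
  refine Finset.sum_congr rfl fun i _ => ?_
  rw [pullback_smul Fin.succAbove_right_injective, map_sub, rename_X, map_one,
    Fin.succ_succAbove_zero, smul_comm, Fin.val_succ, pow_succ, mul_neg_one, neg_smul]

theorem symbZero_smul_pullback_succAbove {m : ℕ} (i : Fin (m + 1)) (f : (Fin (m + 1) → ℤ) → M) :
    symbZero (m + 1) • pullback i.succ.succAbove f =
      (X 0 : MvPolynomial (Fin (m + 2)) ℤ) • pullback i.succ.succAbove (symbZero m • f) := by
  have hi : i.succ ∉ Set.range i.succ.succAbove := by simp
  have hsymb : symb 0 i.succ • pullback i.succ.succAbove f =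
      (X 0 : MvPolynomial (Fin (m + 2)) ℤ) • pullback i.succ.succAbove f := by
    rw [symb, add_smul, one_smul, mul_comm, mul_smul, X_smul_pullback hi, sub_smul, one_smul,
      add_sub_cancel]
  rw [symbZero_succ_eq_rename_mul m i, mul_smul, hsymb, smul_comm,
    pullback_smul Fin.succAbove_right_injective]

theorem symbZero_smul_altSumTail {m : ℕ} (f : (Fin (m + 1) → ℤ) → M) :
    symbZero (m + 1) • altSumTail f =
      (X 0 : MvPolynomial (Fin (m + 2)) ℤ) • altSumTail (symbZero m • f) := by
  simp only [altSumTail, Finset.smul_sum]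
  refine Finset.sum_congr rfl fun i _ => ?_
  rw [smul_comm, symbZero_smul_pullback_succAbove, smul_comm]

theorem swap_comp_succAbove_zero (m : ℕ) :
    Equiv.swap (0 : Fin (m + 2)) 1 ∘ Fin.succAbove 0 = Fin.succAbove 1 := by
  ext j
  cases j using Fin.cases with
  | zero => simp
  | succ j =>
    rw [Function.comp_apply, Fin.zero_succAbove, Equiv.swap_apply_of_ne_of_ne
      (Fin.succ_ne_zero _) (by simp [Fin.ext_iff]), Fin.one_succAbove_succ]

theorem pullback_pullback {σ τ υ : Type*} (g : τ → υ) (h : σ → τ) (f : (σ → ℤ) → M) :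
    pullback g (pullback h f) = pullback (g ∘ h) f := rfl

theorem Antisymm.pullback_swap_altSum {m : ℕ} {f : (Fin (m + 1) → ℤ) → M} (hf : Antisymm f) :
    pullback (Equiv.swap 0 1) (altSum f) = -altSum f := by
  have h01 := swap_comp_succAbove_zero m
  have h10 : Equiv.swap (0 : Fin (m + 2)) 1 ∘ Fin.succAbove 1 = Fin.succAbove 0 := by
    rw [← h01, ← Function.comp_assoc, ← Equiv.coe_trans, Equiv.swap_swap, Equiv.coe_refl,
      Function.id_comp]
  have hrest (i : Fin m) : pullback (Equiv.swap 0 1 ∘ i.succ.succ.succAbove) f =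
      -pullback i.succ.succ.succAbove f := by
    obtain ⟨m, rfl⟩ := Nat.exists_eq_add_of_le' (Nat.one_le_of_lt i.2)
    have hswap := (Fin.succAbove_right_injective (p := i.succ.succ)).swap_comp 0 1
    rw [Fin.succ_succAbove_zero, Fin.succ_succAbove_one, Fin.succ_succAbove_zero,
      Fin.succ_zero_eq_one] at hswap
    rw [hswap, ← pullback_pullback, hf 0 1 Fin.zero_ne_one, map_neg]
  have hsplit : altSum f = pullback (Fin.succAbove 0) f - pullback (Fin.succAbove 1) f +
      ∑ i : Fin m, (-1 : ℤ) ^ (i : ℕ) • pullback i.succ.succ.succAbove f := by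
    rw [altSum, Fin.sum_univ_succ, Fin.sum_univ_succ, ← add_assoc]
    simp [pow_succ, sub_eq_add_neg]
  rw [hsplit, map_add, map_sub, map_sum]
  simp only [map_zsmul, pullback_pullback, h01, h10, hrest, smul_neg, Finset.sum_neg_distrib]
  abel

theorem Antisymm.pullback_swap_succ_of_symbZero_smul_eq {m : ℕ} {f g : (Fin (m + 1) → ℤ) → M}
    (hf : Antisymm f) (hg : g ∈ finiteDegree _ M)
    (h : symbZero m • g = (X 0 - 1 : MvPolynomial (Fin (m + 1)) ℤ) • f) {i j : Fin m}
    (hij : i ≠ j) : pullback (Equiv.swap i.succ j.succ) g = -g := by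
  have h0 : Equiv.swap i.succ j.succ 0 = 0 :=
    Equiv.swap_apply_of_ne_of_ne i.succ_ne_zero.symm j.succ_ne_zero.symm
  refine eq_of_smul_eq_smul (symbZero_mem_invertibleSymbols m)
    (pullback_mem_finiteDegree (Equiv.injective _) hg) (neg_mem hg) ?_
  conv_lhs => rw [← rename_swap_succ_symbZero i j]
  rw [← pullback_smul (Equiv.injective _), h, pullback_smul (Equiv.injective _), map_sub,
    rename_X, map_one, h0, hf _ _ (by simpa using hij), smul_neg, smul_neg, h]

theorem Antisymm.slice_of_symbZero_smul_eq {m : ℕ} {f g : (Fin (m + 1) → ℤ) → M}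
    (hf : Antisymm f) (hg : g ∈ finiteDegree _ M)
    (h : symbZero m • g = (X 0 - 1 : MvPolynomial (Fin (m + 1)) ℤ) • f) (x : ℤ) :
    Antisymm (slice x g) := by
  intro i j hij
  ext l
  have hcons : vecCons x l ∘ Equiv.swap i.succ j.succ = vecCons x (l ∘ Equiv.swap i j) := by
    ext q
    cases q using Fin.cases with
    | zero => simp [Equiv.swap_apply_of_ne_of_ne i.succ_ne_zero.symm j.succ_ne_zero.symm]
    | succ q => simp [← (Fin.succ_injective m).map_swap]
  rw [pullback_apply, slice_apply, ← hcons]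
  exact congrFun (hf.pullback_swap_succ_of_symbZero_smul_eq hg h hij) (vecCons x l)

theorem symb_zero_one_smul_apply {m : ℕ} (F : (Fin (m + 2) → ℤ) → M) (a b : ℤ) (K : Fin m → ℤ) :
    (symb (0 : Fin (m + 2)) 1 • F) (vecCons a (vecCons b K)) =
      F (vecCons a (vecCons b K)) + F (vecCons (a + 1) (vecCons (b + 1) K)) -
        F (vecCons a (vecCons (b + 1) K)) := by
  have h1 : Function.update (vecCons a (vecCons b K)) 1 (b + 1) =
      vecCons a (vecCons (b + 1) K) := by
    rw [← Fin.succ_zero_eq_one, vecCons, vecCons, ← Fin.cons_update, Fin.update_cons_zero]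
    rfl
  have h0 : Function.update (vecCons a (vecCons (b + 1) K)) 0 (a + 1) =
      vecCons (a + 1) (vecCons (b + 1) K) := by
    simp [vecCons]
  rw [symb, mul_sub, mul_one, add_smul, one_smul, sub_smul, mul_smul, ← add_sub_assoc]
  simp [X_smul_apply, h0, h1]

theorem apply_vecCons_self_eq_zero [IsAddTorsionFree M] {m : ℕ} {G : (Fin (m + 2) → ℤ) → M}
    (hG : pullback (Equiv.swap 0 1) G = -G) (a : ℤ) (K : Fin m → ℤ) :
    G (vecCons a (vecCons a K)) = 0 := by
  have hswap : vecCons a (vecCons a K) ∘ Equiv.swap 0 1 = vecCons a (vecCons a K) := by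
    ext q
    rw [Function.comp_apply, Equiv.swap_apply_def]
    split_ifs with h0 h1
    · rw [h0]; rfl
    · rw [h1]; rfl
    · rfl
  have h := congrFun hG (vecCons a (vecCons a K))
  rw [pullback_apply, hswap] at h
  exact self_eq_neg.mp h

theorem pullback_swap_symb_smul {m : ℕ} {G F : (Fin (m + 2) → ℤ) → M}
    (hF : F ∈ finiteDegree _ M) (hG : pullback (Equiv.swap 0 1) G = -G)
    (hFG : prodSymb (m + 2) • F = G) :
    pullback (Equiv.swap 0 1) (symb (0 : Fin (m + 2)) 1 • F) = -(symb (0 : Fin (m + 2)) 1 • F) := by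
  obtain ⟨r, hr, hswap⟩ := exists_prodSymb_eq_symb_mul m
  have hinj : Function.Injective (Equiv.swap (0 : Fin (m + 2)) 1) := Equiv.injective _
  have hsF := Submodule.smul_mem _ (symb (0 : Fin (m + 2)) 1) hF
  refine eq_of_smul_eq_smul (prodSymb_mem_invertibleSymbols (m + 2))
    (pullback_mem_finiteDegree hinj hsF) (neg_mem hsF) ?_
  have hrF : r • pullback (Equiv.swap 0 1) (symb (0 : Fin (m + 2)) 1 • F) =
      r • -(symb (0 : Fin (m + 2)) 1 • F) := by
    conv_lhs => rw [← hswap]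
    rw [← pullback_smul hinj, ← mul_smul, mul_comm r, ← hr, hFG, hG, smul_neg, ← mul_smul,
      mul_comm r, ← hr, hFG]
  rw [hr, mul_smul, hrF, mul_smul]

theorem prod_X_smul_of_pullback_swap {m : ℕ} {G : (Fin (m + 2) → ℤ) → M}
    (hG : pullback (Equiv.swap 0 1) G = -G) :
    pullback (Equiv.swap 0 1) ((∏ i, X i : MvPolynomial (Fin (m + 2)) ℤ) • G) =
      -((∏ i, X i : MvPolynomial (Fin (m + 2)) ℤ) • G) := by
  rw [pullback_smul (Equiv.injective _), hG, smul_neg, map_prod]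
  simp only [rename_X]
  rw [Equiv.prod_comp (Equiv.swap (0 : Fin (m + 2)) 1)
    fun i => (X i : MvPolynomial (Fin (m + 2)) ℤ)]

theorem rename_succ_prodSymb_smul {m : ℕ} {C C' A : (Fin (m + 1) → ℤ) → M}
    (hA : A ∈ finiteDegree _ M) (hC' : C' ∈ finiteDegree _ M)
    (hAC : prodSymb (m + 1) • A = (∏ i, (X i - 1) : MvPolynomial (Fin (m + 1)) ℤ) • C)
    (hCC' : symbZero m • C' = (X 0 - 1 : MvPolynomial (Fin (m + 1)) ℤ) • C) :
    rename Fin.succ (prodSymb m) • A =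
      rename Fin.succ (∏ i, (X i - 1) : MvPolynomial (Fin m) ℤ) • C' := by
  refine eq_of_smul_eq_smul (symbZero_mem_invertibleSymbols m) (Submodule.smul_mem _ _ hA)
    (Submodule.smul_mem _ _ hC') ?_
  rw [← mul_smul, ← prodSymb_succ, hAC, smul_comm, hCC', Fin.prod_univ_succ, mul_comm, mul_smul]
  simp only [map_prod, map_sub, rename_X, map_one]

theorem rename_succ_prodSymb_smul_sub {m : ℕ} {C C' : (Fin (m + 1) → ℤ) → M}
    {F : (Fin (m + 2) → ℤ) → M} (hF : F ∈ finiteDegree _ M) (hC' : C' ∈ finiteDegree _ M)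
    (hFC : prodSymb (m + 2) • F = (∏ i, X i : MvPolynomial (Fin (m + 2)) ℤ) • altSum C)
    (hCC' : symbZero m • C' = (X 0 - 1 : MvPolynomial (Fin (m + 1)) ℤ) • C) :
    rename Fin.succ (prodSymb (m + 1)) • (X 0 - 1 : MvPolynomial (Fin (m + 2)) ℤ) • F =
      -(rename Fin.succ (∏ i, X i : MvPolynomial (Fin (m + 1)) ℤ) • altSumTail C') := by
  refine eq_of_smul_eq_smul (symbZero_mem_invertibleSymbols (m + 1))
    (Submodule.smul_mem _ _ (Submodule.smul_mem _ _ hF))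
    (neg_mem (Submodule.smul_mem _ _ (altSumTail_mem_finiteDegree hC'))) ?_
  rw [← mul_smul, ← prodSymb_succ, smul_comm, hFC, smul_comm, X_zero_sub_one_smul_altSum,
    smul_neg, smul_neg, smul_comm (symbZero (m + 1)), symbZero_smul_altSumTail, hCC',
    Fin.prod_univ_succ, mul_comm, mul_smul]
  simp only [map_prod, rename_X]

end AltSum

theorem rowSum_eq_of_prodSymb_smul {m : ℕ} {C A : (Fin m → ℤ) → ℤ} {F : (Fin (m + 1) → ℤ) → ℤ}
    (hC : C ∈ finiteDegree _ ℤ) (hA : A ∈ finiteDegree _ ℤ) (hF : F ∈ finiteDegree _ ℤ)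
    (hanti : Antisymm C) (hAC : prodSymb m • A = (∏ i, (X i - 1) : MvPolynomial (Fin m) ℤ) • C)
    (hFC : prodSymb (m + 1) • F = (∏ i, X i : MvPolynomial (Fin (m + 1)) ℤ) • altSum C)
    (k : Fin (m + 1) → ℤ) : rowSum m k A = F k := by
  induction m with
  | zero =>
    have hpairs : pairs 0 = ∅ ∧ pairs 1 = ∅ := by decide
    simp only [prodSymb, hpairs, Finset.univ_eq_empty, Finset.prod_empty, one_smul] at hAC hFC
    rw [rowSum, hAC, hFC, prod_X_smul_apply, altSum_apply, Fin.sum_univ_one]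
    simp only [Fin.val_zero, pow_zero, one_smul]
    exact congrArg C (Subsingleton.elim _ _)
  | succ m ih =>
    obtain ⟨C', hC', hCC'⟩ := exists_smul_eq (symbZero_mem_invertibleSymbols m)
      (Submodule.smul_mem _ (X 0 - 1 : MvPolynomial (Fin (m + 1)) ℤ) hC)
    -- The slices of `C'` take the place of `C` in the induction hypothesis.
    have hdiffF := Submodule.smul_mem _ (X 0 - 1 : MvPolynomial (Fin (m + 2)) ℤ) hF
    have hdiff (x : ℤ) (l : Fin (m + 1) → ℤ) :
        rowSum m l (slice x A) = (-(slice x ((X 0 - 1 : MvPolynomial (Fin (m + 2)) ℤ) • F))) l := by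
      refine ih (slice_mem_finiteDegree hC' x) (slice_mem_finiteDegree hA x)
        (neg_mem (slice_mem_finiteDegree hdiffF x)) (hanti.slice_of_symbZero_smul_eq hC' hCC' x)
        ?_ ?_ l
      · rw [← slice_rename_succ_smul, rename_succ_prodSymb_smul hA hC' hAC hCC',
          slice_rename_succ_smul]
      · rw [smul_neg, ← slice_rename_succ_smul, rename_succ_prodSymb_smul_sub hF hC' hFC hCC',
          map_neg, neg_neg, slice_rename_succ_smul, slice_altSumTail]
    refine rowSum_eq_of_vecCons_add_one_of_diagonal (fun a K => ?_) (fun a K => ?_) k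
    · rw [hdiff, Pi.neg_apply, slice_apply, sub_smul, one_smul, Pi.sub_apply, X_smul_apply]
      simp [vecCons]
    · rw [← sub_eq_zero, ← symb_zero_one_smul_apply]
      exact apply_vecCons_self_eq_zero (pullback_swap_symb_smul hF
        (prod_X_smul_of_pullback_swap hanti.pullback_swap_altSum) hFC) a K

/-! ### Determinants of binomial coefficients -/

section ProdFn

variable {σ R : Type*} [Fintype σ] [CommRing R]

/-- The product of functions of the individual coordinates. -/
def prodFn (g : σ → ℤ → R) : (σ → ℤ) → R := fun k => ∏ i, g i (k i)

theorem X_sub_one_smul_prodFn [DecidableEq σ] (g : σ → ℤ → R) (i : σ) :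
    (X i - 1 : MvPolynomial σ ℤ) • prodFn g =
      prodFn (Function.update g i (fwdDiff 1 (g i))) := by
  ext k
  have hrest (h : σ → ℤ → R) (l : σ → ℤ) (hh : ∀ j ≠ i, h j (l j) = g j (k j)) :
      prodFn h l = h i (l i) * ∏ j ∈ {i}ᶜ, g j (k j) := by
    rw [prodFn, Fintype.prod_eq_mul_prod_compl i]
    exact congrArg _ (Finset.prod_congr rfl fun j hj => hh j (by simpa using hj))
  rw [sub_smul, one_smul, Pi.sub_apply, X_smul_apply, hrest g k fun _ _ => rfl,
    hrest g _ fun j hj => by rw [Function.update_of_ne hj],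
    hrest _ k fun j hj => by rw [Function.update_of_ne hj], Function.update_self,
    Function.update_self, fwdDiff, sub_mul]

theorem X_sub_one_pow_smul_prodFn [DecidableEq σ] (g : σ → ℤ → R) (i : σ) (N : ℕ) :
    (X i - 1 : MvPolynomial σ ℤ) ^ N • prodFn g =
      prodFn (Function.update g i ((fwdDiff 1)^[N] (g i))) := by
  induction N with
  | zero => simp
  | succ N ih =>
    rw [pow_succ', mul_smul, ih, X_sub_one_smul_prodFn, Function.update_self,
      Function.update_idem, Function.iterate_succ_apply']

theorem prod_X_sub_one_smul_prodFn (g : σ → ℤ → R) :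
    (∏ i, (X i - 1) : MvPolynomial σ ℤ) • prodFn g = prodFn fun i => fwdDiff 1 (g i) := by
  classical
  have hpartial (s : Finset σ) : (∏ i ∈ s, (X i - 1) : MvPolynomial σ ℤ) • prodFn g =
      prodFn (s.piecewise (fun i => fwdDiff 1 (g i)) g) := by
    induction s using Finset.induction_on with
    | empty => simp
    | insert a s ha ih =>
      rw [Finset.prod_insert ha, mul_smul, ih, X_sub_one_smul_prodFn,
        Finset.piecewise_insert, Finset.piecewise_eq_of_notMem _ _ _ ha]
  simpa using hpartial Finset.univ

theorem prodFn_mem_finiteDegree {g : σ → ℤ → R} (hg : ∀ i, ∃ N, (fwdDiff 1)^[N] (g i) = 0) :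
    prodFn g ∈ finiteDegree σ R := by
  classical
  refine mem_finiteDegree.mpr fun i => ?_
  obtain ⟨N, hN⟩ := hg i
  refine ⟨N, ?_⟩
  rw [X_sub_one_pow_smul_prodFn, hN]
  ext k
  exact Finset.prod_eq_zero (Finset.mem_univ i) (by simp)

end ProdFn

theorem fwdDiff_ringChoose_succ (j : ℕ) :
    fwdDiff 1 (fun x : ℤ => Ring.choose x (j + 1)) = fun x => Ring.choose x j := by
  ext x
  rw [fwdDiff, Ring.choose_succ_succ, add_sub_cancel_right]

theorem fwdDiff_iterate_ringChoose (j : ℕ) :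
    (fwdDiff 1)^[j + 1] (fun x : ℤ => Ring.choose x j) = 0 := by
  induction j with
  | zero => ext x; simp [fwdDiff]
  | succ j ih => rw [Function.iterate_succ_apply, fwdDiff_ringChoose_succ, ih]

/-- The determinant of the binomial coefficients `k_i` choose `j + c`, `0 ≤ j < n`. For `c = 0` it
is `∏_{i < j} (k_j - k_i) / (j - i)`; the shift `c` makes differences of such determinants again
determinants of this kind. -/
noncomputable def chooseDet (c n : ℕ) (k : Fin n → ℤ) : ℤ :=
  (Matrix.of fun i j : Fin n => Ring.choose (k i) ((j : ℕ) + c)).det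

theorem chooseDet_eq_sum (c n : ℕ) : chooseDet c n = ∑ π : Equiv.Perm (Fin n),
    (Equiv.Perm.sign π : ℤ) • prodFn fun i x => Ring.choose x ((π i : ℕ) + c) := by
  ext k
  rw [chooseDet, ← Matrix.det_transpose, Matrix.det_apply', Finset.sum_apply]
  rfl

theorem chooseDet_mem_finiteDegree (c n : ℕ) : chooseDet c n ∈ finiteDegree (Fin n) ℤ := by
  rw [chooseDet_eq_sum]
  exact sum_mem fun π _ => zsmul_mem
    (prodFn_mem_finiteDegree fun _ => ⟨_, fwdDiff_iterate_ringChoose _⟩) _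

theorem prod_X_sub_one_smul_chooseDet (c n : ℕ) :
    (∏ i, (X i - 1) : MvPolynomial (Fin n) ℤ) • chooseDet (c + 1) n = chooseDet c n := by
  simp only [chooseDet_eq_sum, Finset.smul_sum]
  refine Finset.sum_congr rfl fun π _ => ?_
  rw [smul_comm, prod_X_sub_one_smul_prodFn]
  simp only [← add_assoc, fwdDiff_ringChoose_succ]

theorem antisymm_chooseDet (c n : ℕ) : Antisymm (chooseDet c n) := by
  intro i j hij
  ext k
  have h := Matrix.det_permute (Equiv.swap i j)
    (Matrix.of fun i j : Fin n => Ring.choose (k i) ((j : ℕ) + c))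
  rwa [Equiv.Perm.sign_swap hij, Units.val_neg, Units.val_one, Int.cast_neg, Int.cast_one,
    neg_one_mul] at h

theorem altSum_chooseDet (n : ℕ) : altSum (chooseDet 1 n) = chooseDet 0 (n + 1) := by
  ext k
  rw [altSum_apply, chooseDet, Matrix.det_succ_column_zero]
  refine Finset.sum_congr rfl fun i _ => ?_
  rw [Matrix.of_apply, Fin.val_zero, Ring.choose_zero_right, mul_one, smul_eq_mul]
  rfl

theorem chooseDet_add_one (n : ℕ) (k : Fin n → ℤ) :
    chooseDet 0 n (fun i => k i + 1) = chooseDet 0 n k := by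
  cases n with
  | zero => simp [chooseDet]
  | succ n =>
    refine (Matrix.det_eq_of_forall_col_eq_smul_add_pred (fun _ => -1) (by simp) ?_).symm
    intro i j
    simp only [Matrix.of_apply, Fin.val_succ, add_zero, Fin.val_castSucc, Ring.choose_succ_succ]
    ring

theorem prod_X_smul_chooseDet (n : ℕ) :
    (∏ i, X i : MvPolynomial (Fin n) ℤ) • chooseDet 0 n = chooseDet 0 n := by
  ext k
  rw [prod_X_smul_apply, chooseDet_add_one]

theorem alpha_succ (n : ℕ) (k : Fin (n + 1) → ℤ) : alpha (n + 1) k = rowSum n k (alpha n) := by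
  cases n <;> rfl

theorem alpha_mem_finiteDegree_and_prodSymb_smul (n : ℕ) :
    alpha n ∈ finiteDegree (Fin n) ℤ ∧ prodSymb n • alpha n = chooseDet 0 n := by
  induction n with
  | zero =>
    have hdet : alpha 0 = chooseDet 0 0 := by ext k; simp [alpha, chooseDet]
    have hpairs : prodSymb 0 = 1 := by simp [prodSymb, pairs]
    rw [hdet, hpairs, one_smul]
    exact ⟨chooseDet_mem_finiteDegree 0 0, rfl⟩
  | succ n ih =>
    obtain ⟨F, hF, hFC⟩ := exists_smul_eq (prodSymb_mem_invertibleSymbols (n + 1))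
      (chooseDet_mem_finiteDegree 0 (n + 1))
    have halpha : alpha (n + 1) = F := by
      ext k
      rw [alpha_succ]
      refine rowSum_eq_of_prodSymb_smul (chooseDet_mem_finiteDegree 1 n) ih.1 hF
        (antisymm_chooseDet 1 n) ?_ ?_ k
      · rw [ih.2, prod_X_sub_one_smul_chooseDet]
      · rw [hFC, altSum_chooseDet, prod_X_smul_chooseDet]
    exact halpha ▸ ⟨hF, hFC⟩

/-! ### Polynomials as functions on integer points -/

theorem comp_mem_finiteDegree {σ M N : Type*} [AddCommGroup M] [AddCommGroup N] (φ : M →+ N)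
    {f : (σ → ℤ) → M} (hf : f ∈ finiteDegree σ M) : φ ∘ f ∈ finiteDegree σ N := by
  refine mem_finiteDegree.mpr fun i => ?_
  obtain ⟨d, hd⟩ := mem_finiteDegree.mp hf i
  refine ⟨d, ?_⟩
  rw [← comp_smul, hd]
  exact funext fun _ => map_zero φ

section ToFn

variable {n : ℕ}

/-- The function on `ℤⁿ` given by a polynomial. -/
noncomputable def toFn : MvPolynomial (Fin n) ℂ →ₗ[ℂ] ((Fin n → ℤ) → ℂ) where
  toFun P k := evalInt k P
  map_add' _ _ := funext fun _ => map_add _ _ _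
  map_smul' _ _ := funext fun _ => smul_eval _ _ _

theorem toFn_apply (P : MvPolynomial (Fin n) ℂ) (k : Fin n → ℤ) : toFn P k = evalInt k P := rfl

theorem toFn_shift (i : Fin n) (P : MvPolynomial (Fin n) ℂ) :
    toFn (shift i P) = (X i : MvPolynomial (Fin n) ℤ) • toFn P := by
  ext k
  rw [X_smul_apply, toFn_apply, toFn_apply, evalInt, evalInt, shift, AlgHom.toLinearMap_apply,
    ← coe_aeval_eq_eval, ← coe_aeval_eq_eval, RingHom.coe_coe, RingHom.coe_coe,
    ← AlgHom.comp_apply]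
  refine DFunLike.congr_fun (algHom_ext fun j => ?_) P
  rw [AlgHom.comp_apply, aeval_X, aeval_X]
  obtain rfl | h := eq_or_ne j i <;> simp [*]

theorem toFn_diff (i : Fin n) (P : MvPolynomial (Fin n) ℂ) :
    toFn (diff i P) = (X i - 1 : MvPolynomial (Fin n) ℤ) • toFn P := by
  rw [diff, LinearMap.sub_apply, Module.End.one_apply, map_sub, toFn_shift, sub_smul, one_smul]

theorem toFn_diff_pow (i : Fin n) (d : ℕ) (P : MvPolynomial (Fin n) ℂ) :
    toFn ((diff i ^ d) P) = (X i - 1 : MvPolynomial (Fin n) ℤ) ^ d • toFn P := by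
  induction d with
  | zero => rw [pow_zero, pow_zero, one_smul, Module.End.one_apply]
  | succ d ih => rw [pow_succ', pow_succ', mul_smul, ← ih, ← toFn_diff, Module.End.mul_apply]

theorem toFn_factor (x : Fin n × Fin n) (P : MvPolynomial (Fin n) ℂ) :
    toFn (factor x P) = symb x.1 x.2 • toFn P := by
  rw [factor, LinearMap.add_apply, Module.End.one_apply, Module.End.mul_apply, map_add, toFn_shift,
    toFn_diff, symb, add_smul, one_smul, mul_smul]

theorem toFn_noncommProd_factor (s : Finset (Fin n × Fin n))
    (hs : (s : Set (Fin n × Fin n)).Pairwise (Function.onFun Commute factor))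
    (P : MvPolynomial (Fin n) ℂ) :
    toFn (s.noncommProd factor hs P) = (∏ x ∈ s, symb x.1 x.2) • toFn P := by
  induction s using Finset.induction_on with
  | empty => rw [Finset.noncommProd_empty, Finset.prod_empty, one_smul, Module.End.one_apply]
  | insert x s hx ih =>
    rw [Finset.noncommProd_insert_of_notMem _ _ _ _ hx, Finset.prod_insert hx, mul_smul, ← ih,
      ← toFn_factor, Module.End.mul_apply]

theorem toFn_prodOp (P : MvPolynomial (Fin n) ℂ) : toFn (prodOp n P) = prodSymb n • toFn P :=
  toFn_noncommProd_factor (pairs n) (fun x _ y _ _ => factor_commute x y) P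

theorem toFn_mem_finiteDegree (P : MvPolynomial (Fin n) ℂ) : toFn P ∈ finiteDegree (Fin n) ℂ := by
  induction P using MvPolynomial.induction_on' with
  | monomial s a =>
    have hmonomial : toFn (monomial s a) =
        (AddMonoidHom.mulLeft a).comp (Int.castAddHom ℂ) ∘ prodFn fun i x => x ^ s i := by
      ext k
      rw [toFn_apply, evalInt, eval_monomial, Finsupp.prod_fintype _ _ fun _ => pow_zero _]
      simp [prodFn]
    rw [hmonomial]
    exact comp_mem_finiteDegree _ (prodFn_mem_finiteDegree fun i =>
      ⟨s i + 1, fwdDiff_iter_pow_eq_zero_of_lt (Nat.lt_succ_self _)⟩)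
  | add P Q hP hQ => rw [map_add]; exact add_mem hP hQ

theorem eq_zero_of_strictMono {P : MvPolynomial (Fin n) ℂ}
    (h : ∀ k : Fin n → ℤ, StrictMono k → evalInt k P = 0) : P = 0 := by
  set d := P.totalDegree + 1
  -- Consecutive blocks of integers: any choice of one element from each block is increasing.
  refine eq_zero_of_eval_zero_at_prod_finset P
    (fun i => (Finset.range d).image fun t : ℕ => (((i : ℕ) * d + t : ℕ) : ℂ)) (fun i => ?_)
    fun x hx => ?_
  · have hinj : Function.Injective fun t : ℕ => (((i : ℕ) * d + t : ℕ) : ℂ) :=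
      Nat.cast_injective.comp (add_right_injective _)
    rw [Finset.card_image_of_injective _ hinj, Finset.card_range]
    exact Nat.lt_succ_of_le (degreeOf_le_totalDegree _ _)
  · simp only [Finset.mem_image, Finset.mem_range] at hx
    choose t ht hxt using hx
    have hmono : StrictMono fun i : Fin n => (((i : ℕ) * d + t i : ℕ) : ℤ) := fun i j hij => by
      have hblock : ((i : ℕ) + 1) * d ≤ (j : ℕ) * d := Nat.mul_le_mul_right _ hij
      rw [add_mul, one_mul] at hblock
      exact Int.ofNat_lt.mpr (by linarith [ht i])
    simpa only [evalInt, Int.cast_natCast, hxt] using h _ hmono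

theorem toFn_injective : Function.Injective (toFn (n := n)) :=
  (injective_iff_map_eq_zero _).mpr fun _ hP => eq_zero_of_strictMono fun k _ => congrFun hP k

theorem isUnit_factor (x : Fin n × Fin n) : IsUnit (factor x) := by
  refine isUnit_one_add_of_locally_nilpotent fun P => ?_
  obtain ⟨d, hd⟩ := mem_finiteDegree.mp (toFn_mem_finiteDegree P) x.1
  have hdiff : (diff x.1 ^ d) P = 0 := toFn_injective (by rw [toFn_diff_pow, hd, map_zero])
  have hcomm : Commute (shift x.2) (diff x.1) :=
    (shift_commute x.2 x.1).sub_right (Commute.one_right _)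
  exact ⟨d, by rw [hcomm.mul_pow, Module.End.mul_apply, hdiff, map_zero]⟩

end ToFn

theorem commute_ringInverse_left {R : Type*} [MonoidWithZero R] {a b : R} (ha : IsUnit a)
    (h : Commute a b) : Commute (Ring.inverse a) b := by
  obtain ⟨u, rfl⟩ := ha
  rw [Ring.inverse_unit]
  exact h.units_inv_left

theorem noncommProd_mul_noncommProd_ringInverse {ι R : Type*} [MonoidWithZero R] {s : Finset ι}
    {f : ι → R} (hf : ∀ x ∈ s, IsUnit (f x))
    (hs : (s : Set ι).Pairwise (Function.onFun Commute f))
    (hs' : (s : Set ι).Pairwise (Function.onFun Commute fun x => Ring.inverse (f x))) :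
    s.noncommProd f hs * s.noncommProd (fun x => Ring.inverse (f x)) hs' = 1 := by
  rw [← Finset.noncommProd_mul_distrib f (fun x => Ring.inverse (f x)) hs hs'
      fun x hx y hy hxy => commute_ringInverse_left (hf x hx) (hs hx hy hxy),
    Finset.noncommProd_eq_pow_card _ (f * fun x => Ring.inverse (f x)) _ 1
      fun x hx => Ring.mul_inverse_cancel _ (hf x hx), one_pow]

theorem prodOp_prodInvOp_apply {n : ℕ} (P : MvPolynomial (Fin n) ℂ) :
    prodOp n (prodInvOp n P) = P :=
  LinearMap.congr_fun (noncommProd_mul_noncommProd_ringInverse (fun x _ => isUnit_factor x)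
    (fun x _ y _ _ => factor_commute x y)
    fun x _ y _ _ => (factor_commute x y).ringInverse_ringInverse) P

theorem prod_pairs {R : Type*} [CommMonoid R] {n : ℕ} (g : Fin n → Fin n → R) :
    ∏ x ∈ pairs n, g x.1 x.2 = ∏ i, ∏ j ∈ Finset.Ioi i, g i j := by
  have hIoi (i : Fin n) : Finset.Ioi i = Finset.univ.filter (i < ·) := by ext; simp
  simp only [pairs, hIoi, Finset.prod_filter, ← Finset.univ_product_univ, Finset.prod_product]

theorem prod_factorial_mul_chooseDet (n : ℕ) (k : Fin n → ℤ) :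
    (∏ j : Fin n, (Nat.factorial j : ℤ)) * chooseDet 0 n k = ∏ x ∈ pairs n, (k x.2 - k x.1) := by
  have hchoose (i j : Fin n) : (descPochhammer ℤ j).eval (k i) =
      (Nat.factorial j : ℤ) * Ring.choose (k i) (j : ℕ) := by
    rw [Polynomial.eval_eq_smeval, Ring.descPochhammer_eq_factorial_smul_choose, nsmul_eq_mul]
  rw [prod_pairs fun i j => k j - k i, ← Matrix.det_vandermonde,
    Matrix.det_eval_matrixOfPolynomials_eq_det_vandermonde k (fun j => descPochhammer ℤ j)
      (fun j => descPochhammer_natDegree ℤ j) fun j => monic_descPochhammer ℤ j, chooseDet,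
    ← Matrix.det_mul_row]
  simp only [Matrix.of_apply, add_zero, hchoose]

theorem chooseDet_val (n : ℕ) : chooseDet 0 n (fun i => ((i : ℕ) : ℤ)) = 1 := by
  rw [chooseDet, Matrix.det_of_isLowerTriangular]
  · simp [Ring.choose_natCast]
  · intro i j hij
    have hlt : (i : ℕ) < j := hij
    simp [Ring.choose_natCast, Nat.choose_eq_zero_of_lt hlt]

theorem evalInt_vandermonde (n : ℕ) (k : Fin n → ℤ) :
    evalInt k (vandermonde n) = (chooseDet 0 n k : ℂ) := by
  have hk := prod_factorial_mul_chooseDet n k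
  have hval := prod_factorial_mul_chooseDet n fun i => ((i : ℕ) : ℤ)
  rw [chooseDet_val, mul_one] at hval
  have hfactorial : ((∏ j : Fin n, (Nat.factorial j : ℤ) : ℤ) : ℂ) ≠ 0 :=
    Int.cast_ne_zero.mpr (Finset.prod_ne_zero_iff.mpr fun j _ =>
      Int.natCast_ne_zero.mpr (Nat.factorial_ne_zero _))
  have heval : evalInt k (vandermonde n) =
      ((∏ x ∈ pairs n, (((x.2 : ℕ) : ℤ) - ((x.1 : ℕ) : ℤ)) : ℤ) : ℂ)⁻¹ *
        ((∏ x ∈ pairs n, (k x.2 - k x.1) : ℤ) : ℂ) := by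
    simp [evalInt, vandermonde, Finset.prod_mul_distrib]
  rw [heval, ← hval, ← hk, Int.cast_mul, inv_mul_cancel_left₀ hfactorial]

theorem evalInt_prodInvOp_vandermonde (n : ℕ) (k : Fin n → ℤ) :
    evalInt k (prodInvOp n (vandermonde n)) = alpha n k := by
  obtain ⟨halpha, hsymb⟩ := alpha_mem_finiteDegree_and_prodSymb_smul n
  have hfun : toFn (prodInvOp n (vandermonde n)) = Int.castAddHom ℂ ∘ alpha n := by
    refine eq_of_smul_eq_smul (prodSymb_mem_invertibleSymbols n) (toFn_mem_finiteDegree _)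
      (comp_mem_finiteDegree _ halpha) ?_
    rw [← toFn_prodOp, prodOp_prodInvOp_apply, ← comp_smul, hsymb]
    ext k
    exact evalInt_vandermonde n k
  exact congrFun hfun k

/-! ### Triangles with a given bottom row -/

section Rows

variable {n : ℕ}

open scoped Classical in
/-- The rows that may stand above the row `k` in a monotone triangle. -/
noncomputable def rowsAbove (k : Fin (n + 1) → ℤ) : Finset (Fin n → ℤ) :=
  {l ∈ Fintype.piFinset fun i => Finset.Icc (k i.castSucc) (k i.succ) | StrictMono l}

/-- The rows that may stand above the strictly increasing row `k` in a monotone triangle that is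
strictly increasing in southeast direction. -/
noncomputable def strictRowsAbove (k : Fin (n + 1) → ℤ) : Finset (Fin n → ℤ) :=
  Fintype.piFinset fun i => Finset.Ico (k i.castSucc) (k i.succ)

theorem mem_rowsAbove {k : Fin (n + 1) → ℤ} {l : Fin n → ℤ} :
    l ∈ rowsAbove k ↔ (∀ i, k i.castSucc ≤ l i ∧ l i ≤ k i.succ) ∧ StrictMono l := by
  simp only [rowsAbove, Finset.mem_filter, Fintype.mem_piFinset, Finset.mem_Icc]

theorem mem_strictRowsAbove {k : Fin (n + 1) → ℤ} {l : Fin n → ℤ} :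
    l ∈ strictRowsAbove k ↔ ∀ i, k i.castSucc ≤ l i ∧ l i < k i.succ := by
  simp only [strictRowsAbove, Fintype.mem_piFinset, Finset.mem_Ico]

theorem mem_rowsAbove_of_mem_strictRowsAbove {k : Fin (n + 1) → ℤ} (hk : StrictMono k)
    {l : Fin n → ℤ} (hl : l ∈ strictRowsAbove k) : l ∈ rowsAbove k := by
  rw [mem_strictRowsAbove] at hl
  refine mem_rowsAbove.mpr ⟨fun i => ⟨(hl i).1, (hl i).2.le⟩, fun i j hij => ?_⟩
  calc l i < k i.succ := (hl i).2
    _ ≤ k j.castSucc := hk.monotone (Fin.succ_le_castSucc_iff.mpr hij)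
    _ ≤ l j := (hl j).1

end Rows

namespace MonotoneTriangle

variable {n : ℕ}

/-- The bottom row of a monotone triangle. -/
def bottomRow (t : MonotoneTriangle n) : Fin n → ℤ :=
  fun j => t.entry n ((j : ℕ) + 1)

theorem hasBottomRow_iff (t : MonotoneTriangle n) (k : Fin n → ℤ) :
    t.HasBottomRow k ↔ t.bottomRow = k :=
  funext_iff.symm

theorem strictMono_bottomRow (t : MonotoneTriangle n) : StrictMono t.bottomRow := by
  cases n with
  | zero => exact fun i => i.elim0
  | succ n =>
    exact Fin.strictMono_iff_lt_succ.mpr fun i =>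
      t.row_strict (n + 1) (i + 1) (by simp) (by simp) le_rfl

instance : Unique (MonotoneTriangle 0) where
  default := ⟨fun _ _ => 0, by lia, by lia, by lia, fun _ _ _ => rfl⟩
  uniq t := by
    ext i j
    exact t.zeros i j (by lia)

/-- The triangle without its bottom row. -/
def upper (t : MonotoneTriangle (n + 1)) : MonotoneTriangle n where
  entry i j := if i ≤ n then t.entry i j else 0
  northeast i j h1 h2 h3 := by
    rw [if_pos h3, if_pos (by lia)]
    exact t.northeast i j h1 h2 (by lia)
  southeast i j h1 h2 h3 := by
    rw [if_pos h3, if_pos (by lia)]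
    exact t.southeast i j h1 h2 (by lia)
  row_strict i j h1 h2 h3 := by
    rw [if_pos h3, if_pos h3]
    exact t.row_strict i j h1 h2 (by lia)
  zeros i j h := by
    split_ifs with hi
    · exact t.zeros i j (by lia)
    · rfl

theorem upper_entry (t : MonotoneTriangle (n + 1)) {i : ℕ} (hi : i ≤ n) (j : ℕ) :
    t.upper.entry i j = t.entry i j :=
  if_pos hi

theorem bottomRow_upper (t : MonotoneTriangle (n + 1)) (i : Fin n) :
    t.upper.bottomRow i = t.entry n (i + 1) :=
  t.upper_entry le_rfl _

theorem ext_bottomRow_upper {t t' : MonotoneTriangle (n + 1)}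
    (hbottom : t.bottomRow = t'.bottomRow) (hupper : t.upper = t'.upper) : t = t' := by
  ext i j
  by_cases hrange : 1 ≤ j ∧ j ≤ i ∧ i ≤ n + 1
  · obtain hi | rfl := Nat.le_or_eq_of_le_succ hrange.2.2
    · rw [← t.upper_entry hi, ← t'.upper_entry hi, hupper]
    · simpa only [bottomRow, Nat.sub_add_cancel hrange.1] using
        congrFun hbottom ⟨j - 1, by lia⟩
  · rw [t.zeros i j hrange, t'.zeros i j hrange]

theorem bottomRow_upper_mem_rowsAbove (t : MonotoneTriangle (n + 1)) :
    t.upper.bottomRow ∈ rowsAbove t.bottomRow := by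
  refine mem_rowsAbove.mpr ⟨fun i => ?_, t.upper.strictMono_bottomRow⟩
  rw [bottomRow_upper]
  exact ⟨t.northeast n (i + 1) (by simp) i.2 le_rfl, t.southeast n (i + 1) (by simp) i.2 le_rfl⟩

theorem strictSoutheast_iff (t : MonotoneTriangle (n + 1)) :
    t.StrictSoutheast ↔
      t.upper.bottomRow ∈ strictRowsAbove t.bottomRow ∧ t.upper.StrictSoutheast := by
  rw [mem_strictRowsAbove]
  constructor
  · intro ht
    refine ⟨fun i => ⟨((mem_rowsAbove.mp t.bottomRow_upper_mem_rowsAbove).1 i).1, ?_⟩, ?_⟩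
    · rw [bottomRow_upper]
      exact ht n (i + 1) (by simp) i.2 le_rfl
    · intro i j h1 h2 h3
      rw [t.upper_entry h3, t.upper_entry (by lia)]
      exact ht i j h1 h2 (by lia)
  · rintro ⟨hbottom, hupper⟩ i j h1 h2 h3
    obtain hi | hi := Nat.le_or_eq_of_le_succ h3
    · rw [← t.upper_entry hi, ← t.upper_entry (by lia : i ≤ n)]
      exact hupper i j h1 h2 hi
    · obtain rfl := Nat.succ_injective hi
      have h := (hbottom ⟨j - 1, by lia⟩).2
      rw [bottomRow_upper] at h
      simpa only [bottomRow, Fin.succ_mk, Nat.sub_add_cancel h1] using h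

/-- The triangle with a further row `k` below. -/
def extend (t : MonotoneTriangle n) {k : Fin (n + 1) → ℤ} (hk : StrictMono k)
    (h : t.bottomRow ∈ rowsAbove k) : MonotoneTriangle (n + 1) where
  entry i j := if i = n + 1 then (if hj : 1 ≤ j ∧ j ≤ n + 1 then k ⟨j - 1, by lia⟩ else 0)
    else t.entry i j
  northeast i j h1 h2 h3 := by
    rw [if_neg (by lia : ¬ i = n + 1)]
    split_ifs with hi hj
    · obtain rfl : i = n := by lia
      obtain ⟨j, rfl⟩ := Nat.exists_eq_add_of_le' h1
      exact ((mem_rowsAbove.mp h).1 ⟨j, by lia⟩).1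
    · lia
    · exact t.northeast i j h1 h2 (by lia)
  southeast i j h1 h2 h3 := by
    rw [if_neg (by lia : ¬ i = n + 1)]
    split_ifs with hi hj
    · obtain rfl : i = n := by lia
      obtain ⟨j, rfl⟩ := Nat.exists_eq_add_of_le' h1
      exact ((mem_rowsAbove.mp h).1 ⟨j, by lia⟩).2
    · lia
    · exact t.southeast i j h1 h2 (by lia)
  row_strict i j h1 h2 h3 := by
    by_cases hi : i = n + 1
    · rw [if_pos hi, if_pos hi, dif_pos (by lia), dif_pos (by lia)]
      exact hk (Fin.mk_lt_mk.mpr (by lia))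
    · rw [if_neg hi, if_neg hi]
      exact t.row_strict i j h1 h2 (by lia)
  zeros i j hz := by
    split_ifs with hi hj
    · lia
    · rfl
    · exact t.zeros i j (by lia)

theorem bottomRow_extend (t : MonotoneTriangle n) {k : Fin (n + 1) → ℤ} (hk : StrictMono k)
    (h : t.bottomRow ∈ rowsAbove k) : (t.extend hk h).bottomRow = k := by
  ext j
  exact (if_pos rfl).trans (dif_pos ⟨by simp, j.2⟩)

theorem upper_extend (t : MonotoneTriangle n) {k : Fin (n + 1) → ℤ} (hk : StrictMono k)
    (h : t.bottomRow ∈ rowsAbove k) : (t.extend hk h).upper = t := by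
  ext i j
  by_cases hi : i ≤ n
  · exact (upper_entry _ hi j).trans (if_neg (by lia))
  · rw [zeros _ i j (by lia), t.zeros i j (by lia)]

/-- The monotone triangles with bottom row `k`. -/
def withBottomRow (k : Fin n → ℤ) : Set (MonotoneTriangle n) :=
  {t | t.HasBottomRow k}

/-- The monotone triangles with bottom row `k` that are strictly increasing in southeast
direction. -/
def strictWithBottomRow (k : Fin n → ℤ) : Set (MonotoneTriangle n) :=
  {t | t.HasBottomRow k ∧ t.StrictSoutheast}

theorem injOn_upper (k : Fin (n + 1) → ℤ) : Set.InjOn upper (withBottomRow k) := by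
  intro t ht t' ht' h
  exact ext_bottomRow_upper
    (((hasBottomRow_iff t k).mp ht).trans ((hasBottomRow_iff t' k).mp ht').symm) h

theorem pairwiseDisjoint_withBottomRow (s : Set (Fin n → ℤ)) :
    s.PairwiseDisjoint withBottomRow := by
  refine (Set.pairwiseDisjoint_fiber bottomRow s).mono fun k t ht => ?_
  exact (t.hasBottomRow_iff k).mp ht

theorem finite_withBottomRow (k : Fin n → ℤ) : (withBottomRow k).Finite := by
  induction n with
  | zero => exact Set.toFinite _
  | succ n ih =>
    refine Set.Finite.of_finite_image (f := upper) ?_ (injOn_upper k)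
    refine ((rowsAbove k).finite_toSet.biUnion fun l _ => ih l).subset ?_
    rintro _ ⟨t, ht, rfl⟩
    rw [withBottomRow, Set.mem_ofPred, hasBottomRow_iff] at ht
    exact Set.mem_biUnion (ht ▸ t.bottomRow_upper_mem_rowsAbove) fun _ => rfl

theorem image_upper_withBottomRow {k : Fin (n + 1) → ℤ} (hk : StrictMono k) :
    upper '' withBottomRow k = ⋃ l ∈ (rowsAbove k : Set (Fin n → ℤ)), withBottomRow l := by
  ext t
  simp only [Set.mem_image, Set.mem_iUnion₂, withBottomRow, Set.mem_ofPred, hasBottomRow_iff]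
  constructor
  · rintro ⟨t, rfl, rfl⟩
    exact ⟨_, t.bottomRow_upper_mem_rowsAbove, rfl⟩
  · rintro ⟨_, hl, rfl⟩
    exact ⟨t.extend hk hl, t.bottomRow_extend hk hl, t.upper_extend hk hl⟩

theorem image_upper_strictWithBottomRow {k : Fin (n + 1) → ℤ} (hk : StrictMono k) :
    upper '' strictWithBottomRow k =
      ⋃ l ∈ (strictRowsAbove k : Set (Fin n → ℤ)), strictWithBottomRow l := by
  ext t
  simp only [Set.mem_image, Set.mem_iUnion₂, strictWithBottomRow, Set.mem_ofPred,
    hasBottomRow_iff]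
  constructor
  · rintro ⟨t, ⟨rfl, ht⟩, rfl⟩
    rw [strictSoutheast_iff] at ht
    exact ⟨_, ht.1, rfl, ht.2⟩
  · rintro ⟨_, hl, rfl, ht⟩
    have hl' := mem_rowsAbove_of_mem_strictRowsAbove hk hl
    refine ⟨t.extend hk hl', ⟨t.bottomRow_extend hk hl', ?_⟩, t.upper_extend hk hl'⟩
    rw [strictSoutheast_iff, bottomRow_extend, upper_extend]
    exact ⟨hl, ht⟩

end MonotoneTriangle

open MonotoneTriangle

theorem countMT_succ {n : ℕ} {k : Fin (n + 1) → ℤ} (hk : StrictMono k) :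
    countMT (n + 1) k = ∑ l ∈ rowsAbove k, countMT n l := by
  calc countMT (n + 1) k = (upper '' withBottomRow k).ncard :=
        (injOn_upper k).ncard_image.symm
    _ = ∑ᶠ l ∈ (rowsAbove k : Set (Fin n → ℤ)), (withBottomRow l).ncard := by
        rw [image_upper_withBottomRow hk]
        exact (rowsAbove k).finite_toSet.ncard_biUnion (fun l _ => finite_withBottomRow l)
          (pairwiseDisjoint_withBottomRow _)
    _ = ∑ l ∈ rowsAbove k, countMT n l := finsum_mem_coe_finset _ _

theorem countStrictMT_succ {n : ℕ} {k : Fin (n + 1) → ℤ} (hk : StrictMono k) :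
    countStrictMT (n + 1) k = ∑ l ∈ strictRowsAbove k, countStrictMT n l := by
  have hsub {m : ℕ} (l : Fin m → ℤ) : strictWithBottomRow l ⊆ withBottomRow l :=
    fun _ ht => ht.1
  calc countStrictMT (n + 1) k = (upper '' strictWithBottomRow k).ncard :=
        ((injOn_upper k).mono (hsub k)).ncard_image.symm
    _ = ∑ᶠ l ∈ (strictRowsAbove k : Set (Fin n → ℤ)), (strictWithBottomRow l).ncard := by
        rw [image_upper_strictWithBottomRow hk]
        exact (strictRowsAbove k).finite_toSet.ncard_biUnion
          (fun l _ => (finite_withBottomRow l).subset (hsub l))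
          ((pairwiseDisjoint_withBottomRow _).mono hsub)
    _ = ∑ l ∈ strictRowsAbove k, countStrictMT n l := finsum_mem_coe_finset _ _

theorem countMT_zero (k : Fin 0 → ℤ) : countMT 0 k = 1 :=
  Nat.card_eq_one_iff_unique.mpr ⟨inferInstance, ⟨default, fun i => i.elim0⟩⟩

theorem countStrictMT_zero (k : Fin 0 → ℤ) : countStrictMT 0 k = 1 :=
  Nat.card_eq_one_iff_unique.mpr ⟨inferInstance, ⟨default, fun i => i.elim0, fun _ _ => by lia⟩⟩

theorem strictMono_vecCons_iff {n : ℕ} {x : ℤ} {l : Fin n → ℤ} :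
    StrictMono (vecCons x l) ↔ (∀ i, x < l i) ∧ StrictMono l := by
  constructor
  · intro h
    exact ⟨fun i => h (Fin.succ_pos i), fun i j hij => h (Fin.succ_lt_succ_iff.mpr hij)⟩
  · rintro ⟨hx, hl⟩ i j hij
    cases j using Fin.cases with
    | zero => exact absurd hij (Fin.not_lt_zero _)
    | succ j =>
      cases i using Fin.cases with
      | zero => exact hx j
      | succ i => exact hl (Fin.succ_lt_succ_iff.mp hij)

theorem le_vecCons {n : ℕ} {c : ℤ} {K : Fin n → ℤ} (hK : ∀ i, c ≤ K i) (j : Fin (n + 1)) :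
    c ≤ vecCons c K j := by
  cases j using Fin.cases with
  | zero => exact le_rfl
  | succ i => exact hK i

theorem vecCons_mem_rowsAbove {n : ℕ} {a b x : ℤ} {K l : Fin n → ℤ} :
    vecCons x l ∈ rowsAbove (vecCons a (vecCons b K)) ↔
      x ∈ Finset.Icc a b ∧ (∀ i, x < l i) ∧ l ∈ rowsAbove (vecCons b K) := by
  rw [mem_rowsAbove, mem_rowsAbove, Fin.forall_fin_succ, strictMono_vecCons_iff]
  simp only [Fin.castSucc_zero, Matrix.cons_val_zero, Matrix.cons_val_succ, ← Fin.succ_castSucc,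
    Finset.mem_Icc]
  tauto

open scoped Classical in
theorem sum_rowsAbove_vecCons {n : ℕ} (a b : ℤ) (K : Fin n → ℤ) (A : (Fin (n + 1) → ℤ) → ℤ) :
    ∑ l ∈ rowsAbove (vecCons a (vecCons b K)), A l =
      ∑ x ∈ Finset.Icc a b, ∑ l ∈ rowsAbove (vecCons b K) with ∀ i, x < l i, slice x A l := by
  rw [Finset.sum_sigma']
  refine Finset.sum_bij' (fun l _ => ⟨l 0, Fin.tail l⟩) (fun x _ => vecCons x.1 x.2)
    ?_ ?_ ?_ ?_ ?_
  · intro l hl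
    rw [← Matrix.cons_head_tail l, vecCons_mem_rowsAbove] at hl
    rw [Finset.mem_sigma, Finset.mem_filter]
    exact ⟨hl.1, hl.2.2, hl.2.1⟩
  · rintro ⟨x, l⟩ hxl
    rw [Finset.mem_sigma, Finset.mem_filter] at hxl
    exact vecCons_mem_rowsAbove.mpr ⟨hxl.1, hxl.2.2, hxl.2.1⟩
  · exact fun l _ => Matrix.cons_head_tail l
  · exact fun _ _ => rfl
  · exact fun l _ => congrArg A (Matrix.cons_head_tail l).symm

theorem le_of_mem_rowsAbove_vecCons {n : ℕ} {c : ℤ} {K l : Fin n → ℤ} (hK : ∀ i, c ≤ K i)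
    (hl : l ∈ rowsAbove (vecCons c K)) (i : Fin n) : c ≤ l i :=
  (le_vecCons hK _).trans ((mem_rowsAbove.mp hl).1 i).1

theorem forall_lt_and_mem_rowsAbove_vecCons {n : ℕ} {b : ℤ} {K l : Fin n → ℤ}
    (hK : ∀ i, b < K i) : ((∀ i, b < l i) ∧ l ∈ rowsAbove (vecCons b K)) ↔
      l ∈ rowsAbove (vecCons (b + 1) K) := by
  constructor
  · rintro ⟨hbl, hl⟩
    obtain ⟨hl, hmono⟩ := mem_rowsAbove.mp hl
    refine mem_rowsAbove.mpr ⟨fun i => ⟨?_, (hl i).2⟩, hmono⟩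
    cases n with
    | zero => exact i.elim0
    | succ n =>
      cases i using Fin.cases with
      | zero => exact hbl 0
      | succ i => exact (hl i.succ).1
  · intro hl
    refine ⟨fun i => le_of_mem_rowsAbove_vecCons hK hl i, ?_⟩
    obtain ⟨hl, hmono⟩ := mem_rowsAbove.mp hl
    refine mem_rowsAbove.mpr ⟨fun i => ⟨le_trans ?_ (hl i).1, (hl i).2⟩, hmono⟩
    generalize i.castSucc = j
    cases j using Fin.cases with
    | zero => exact (lt_add_one b).le
    | succ j => exact le_rfl

theorem rowSum_eq_sum_rowsAbove {n : ℕ} {a : ℤ} {K : Fin n → ℤ} (hK : StrictMono K)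
    (ha : ∀ i, a ≤ K i) (A : (Fin n → ℤ) → ℤ) :
    rowSum n (vecCons a K) A = ∑ l ∈ rowsAbove (vecCons a K), A l := by
  classical
  induction n generalizing a with
  | zero =>
    have hrows : rowsAbove (vecCons a K) = {![]} := by
      ext l
      simp [mem_rowsAbove, Subsingleton.elim l ![], Subsingleton.strictMono]
    rw [hrows, Finset.sum_singleton, rowSum]
  | succ n ih =>
    obtain ⟨b, K, rfl⟩ : ∃ b K', K = vecCons b K' := ⟨_, _, (Matrix.cons_head_tail K).symm⟩
    obtain ⟨hbK, hK⟩ := strictMono_vecCons_iff.mp hK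
    have hab : a ≤ b := ha 0
    have hbelow {x : ℤ} (hx : x < b) :
        {l ∈ rowsAbove (vecCons b K) | ∀ i, x < l i} = rowsAbove (vecCons b K) :=
      Finset.filter_true_of_mem fun l hl i =>
        hx.trans_le (le_of_mem_rowsAbove_vecCons (fun i => (hbK i).le) hl i)
    have hlast : {l ∈ rowsAbove (vecCons b K) | ∀ i, b < l i} = rowsAbove (vecCons (b + 1) K) := by
      ext l
      rw [Finset.mem_filter, and_comm, forall_lt_and_mem_rowsAbove_vecCons hbK]
    rw [rowSum_vecCons, extSum_of_le (by lia), ih hK hbK, sum_rowsAbove_vecCons,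
      ← Finset.insert_Icc_sub_one_right_eq_Icc hab, Finset.sum_insert (by simp), hlast, add_comm]
    congr 1
    refine Finset.sum_congr rfl fun x hx => ?_
    rw [hbelow (by rw [Finset.mem_Icc] at hx; lia), ih hK fun i => (hbK i).le]

theorem countMT_eq_alpha (n : ℕ) (k : Fin n → ℤ) (hk : StrictMono k) :
    (countMT n k : ℤ) = alpha n k := by
  induction n with
  | zero => rw [countMT_zero]; rfl
  | succ n ih =>
    obtain ⟨a, K, rfl⟩ : ∃ a K, k = vecCons a K := ⟨_, _, (Matrix.cons_head_tail k).symm⟩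
    obtain ⟨haK, hK⟩ := strictMono_vecCons_iff.mp hk
    rw [alpha_succ, rowSum_eq_sum_rowsAbove hK fun i => (haK i).le, countMT_succ hk, Nat.cast_sum]
    exact Finset.sum_congr rfl fun l hl => ih l (mem_rowsAbove.mp hl).2

theorem sum_Ico_ringChoose {a b : ℤ} (h : a ≤ b) (j : ℕ) :
    ∑ x ∈ Finset.Ico a b, Ring.choose x j = Ring.choose b (j + 1) - Ring.choose a (j + 1) := by
  induction b, h using Int.leInduction with
  | base => simp
  | succ b hb ih =>
    rw [← Finset.insert_Ico_right_eq_Ico_add_one hb, Finset.sum_insert (by simp), ih,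
      Ring.choose_succ_succ]
    ring

theorem chooseDet_succ (n : ℕ) (k : Fin (n + 1) → ℤ) : chooseDet 0 (n + 1) k =
    (Matrix.of fun i j : Fin n => Ring.choose (k i.succ) ((j : ℕ) + 1) -
      Ring.choose (k i.castSucc) ((j : ℕ) + 1)).det := by
  have hrows : chooseDet 0 (n + 1) k = (Matrix.of fun i j : Fin (n + 1) =>
      (Fin.cases (Ring.choose (k 0) (j : ℕ)) (fun i => Ring.choose (k i.succ) (j : ℕ) -
        Ring.choose (k i.castSucc) (j : ℕ)) i : ℤ)).det :=
    Matrix.det_eq_of_forall_row_eq_smul_add_pred (fun _ => 1) (by simp) (by simp)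
  rw [hrows, Matrix.det_succ_column_zero, Fin.sum_univ_succ]
  simp only [Matrix.of_apply, Fin.val_zero, Ring.choose_zero_right, sub_self, Fin.cases_succ,
    Fin.cases_zero, mul_zero, zero_mul, Finset.sum_const_zero, add_zero, pow_zero, one_mul]
  rfl

theorem sum_strictRowsAbove_chooseDet {n : ℕ} {k : Fin (n + 1) → ℤ} (hk : Monotone k) :
    ∑ l ∈ strictRowsAbove k, chooseDet 0 n l = chooseDet 0 (n + 1) k := by
  have hperm (π : Equiv.Perm (Fin n)) :
      ∑ l ∈ strictRowsAbove k, prodFn (fun i x => Ring.choose x (π i : ℕ)) l =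
        ∏ i, (Ring.choose (k i.succ) ((π i : ℕ) + 1) -
          Ring.choose (k i.castSucc) ((π i : ℕ) + 1)) :=
    (Finset.prod_univ_sum _ fun i x => Ring.choose x (π i : ℕ)).symm.trans <|
      Finset.prod_congr rfl fun i _ => sum_Ico_ringChoose (hk (Fin.castSucc_lt_succ).le) _
  rw [chooseDet_succ, ← Matrix.det_transpose, Matrix.det_apply', chooseDet_eq_sum]
  simp only [Finset.sum_apply, Pi.smul_apply, smul_eq_mul, add_zero]
  rw [Finset.sum_comm]
  simp only [← Finset.mul_sum, hperm]
  rfl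

theorem countStrictMT_eq_chooseDet (n : ℕ) (k : Fin n → ℤ) (hk : StrictMono k) :
    (countStrictMT n k : ℤ) = chooseDet 0 n k := by
  induction n with
  | zero => simp [countStrictMT_zero, chooseDet]
  | succ n ih =>
    rw [countStrictMT_succ hk, Nat.cast_sum, ← sum_strictRowsAbove_chooseDet hk.monotone]
    exact Finset.sum_congr rfl fun l hl =>
      ih l (mem_rowsAbove.mp (mem_rowsAbove_of_mem_strictRowsAbove hk hl)).2

/-! ### Semistandard tableaux -/

section BelowDiagram

variable {μ : YoungDiagram}

/-- The Young diagram of the cells of a semistandard tableau whose entry is less than `i`. -/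
def belowDiagram (T : SemistandardYoungTableau μ) (i : ℕ) : YoungDiagram where
  cells := {x ∈ μ.cells | T x.1 x.2 < i}
  isLowerSet := by
    rintro ⟨r, c⟩ ⟨r', c'⟩ ⟨hr, hc⟩ h
    simp only [Finset.coe_filter, Set.mem_ofPred, YoungDiagram.mem_cells] at h ⊢
    refine ⟨μ.up_left_mem hr hc h.1, lt_of_le_of_lt ?_ h.2⟩
    exact (T.row_weak_of_le hc (μ.up_left_mem hr le_rfl h.1)).trans (T.col_weak hr h.1)

theorem mem_belowDiagram {T : SemistandardYoungTableau μ} {i r c : ℕ} :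
    (r, c) ∈ belowDiagram T i ↔ (r, c) ∈ μ ∧ T r c < i := by
  rw [← YoungDiagram.mem_cells, belowDiagram, Finset.mem_filter, YoungDiagram.mem_cells]

theorem rowLen_le_rowLen {ν : YoungDiagram} {r s : ℕ} (h : ∀ c, (r, c) ∈ μ → (s, c) ∈ ν) :
    μ.rowLen r ≤ ν.rowLen s := by
  by_contra! hlt
  have hmem := h _ (YoungDiagram.mem_iff_lt_rowLen.mpr hlt)
  exact lt_irrefl _ (YoungDiagram.mem_iff_lt_rowLen.mp hmem)

theorem rowLen_eq_zero_of_colLen_le {r : ℕ} (hr : μ.colLen 0 ≤ r) : μ.rowLen r = 0 := by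
  by_contra h
  have hmem : (r, 0) ∈ μ := YoungDiagram.mem_iff_lt_rowLen.mpr (Nat.pos_of_ne_zero h)
  exact hr.not_gt (YoungDiagram.mem_iff_lt_colLen.mp hmem)

theorem belowDiagram_eq_self {T : SemistandardYoungTableau μ} {i : ℕ}
    (hT : ∀ r c, (r, c) ∈ μ → T r c < i) : belowDiagram T i = μ := by
  ext ⟨r, c⟩
  rw [YoungDiagram.mem_cells, YoungDiagram.mem_cells, mem_belowDiagram, and_iff_left_iff_imp]
  exact hT r c

theorem rowLen_belowDiagram_le_succ (T : SemistandardYoungTableau μ) (i r : ℕ) :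
    (belowDiagram T i).rowLen r ≤ (belowDiagram T (i + 1)).rowLen r := by
  refine rowLen_le_rowLen fun c => ?_
  rw [mem_belowDiagram, mem_belowDiagram]
  exact And.imp_right Nat.lt_succ_of_lt

theorem rowLen_belowDiagram_succ_succ_le (T : SemistandardYoungTableau μ) (i r : ℕ) :
    (belowDiagram T (i + 1)).rowLen (r + 1) ≤ (belowDiagram T i).rowLen r := by
  refine rowLen_le_rowLen fun c => ?_
  rw [mem_belowDiagram, mem_belowDiagram]
  rintro ⟨hmem, hlt⟩
  have hcol := T.col_strict r.lt_succ_self hmem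
  exact ⟨μ.up_left_mem r.le_succ le_rfl hmem, by lia⟩

theorem le_tableau_entry (T : SemistandardYoungTableau μ) {r c : ℕ} (h : (r, c) ∈ μ) :
    r ≤ T r c := by
  induction r with
  | zero => exact Nat.zero_le _
  | succ r ih =>
    exact (ih (μ.up_left_mem r.le_succ le_rfl h)).trans_lt (T.col_strict r.lt_succ_self h)

theorem rowLen_belowDiagram_of_le (T : SemistandardYoungTableau μ) {i r : ℕ} (h : i ≤ r) :
    (belowDiagram T i).rowLen r = 0 := by
  by_contra h0
  have hmem := YoungDiagram.mem_iff_lt_rowLen.mpr (Nat.pos_of_ne_zero h0)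
  obtain ⟨hmem, hlt⟩ := mem_belowDiagram.mp hmem
  exact (h.trans (le_tableau_entry T hmem)).not_gt hlt

theorem tableau_ext_belowDiagram {T T' : SemistandardYoungTableau μ} {n : ℕ}
    (hT : ∀ r c, (r, c) ∈ μ → T r c < n) (hT' : ∀ r c, (r, c) ∈ μ → T' r c < n)
    (h : ∀ i ≤ n, ∀ r, (belowDiagram T i).rowLen r = (belowDiagram T' i).rowLen r) : T = T' := by
  ext r c
  by_cases hc : (r, c) ∈ μ
  · have hlt (i : ℕ) (hi : i ≤ n) : T r c < i ↔ T' r c < i := by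
      rw [← and_iff_right (b := T r c < i) hc, ← and_iff_right (b := T' r c < i) hc,
        ← mem_belowDiagram, ← mem_belowDiagram, YoungDiagram.mem_iff_lt_rowLen,
        YoungDiagram.mem_iff_lt_rowLen, h i hi]
    exact le_antisymm
      (Nat.lt_succ_iff.mp ((hlt _ (hT' r c hc)).mpr (Nat.lt_succ_self _)))
      (Nat.lt_succ_iff.mp ((hlt _ (hT r c hc)).mp (Nat.lt_succ_self _)))
  · rw [T.zeros hc, T'.zeros hc]

/-- The monotone triangle of a semistandard tableau: its `i`-th row, minus `(1, …, i)` and read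
from right to left, is the shape formed by the entries less than `i`. -/
def tableauTriangle (T : SemistandardYoungTableau μ) (n : ℕ) : MonotoneTriangle n where
  entry i j := if 1 ≤ j ∧ j ≤ i ∧ i ≤ n then (belowDiagram T i).rowLen (i - j) + (j : ℤ) else 0
  northeast i j h1 h2 h3 := by
    have h := rowLen_belowDiagram_succ_succ_le T i (i - j)
    rw [if_pos (by lia), if_pos (by lia), Nat.sub_add_comm h2]
    lia
  southeast i j h1 h2 h3 := by
    have h := rowLen_belowDiagram_le_succ T i (i - j)
    rw [if_pos (by lia), if_pos (by lia), Nat.add_sub_add_right]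
    lia
  row_strict i j h1 h2 h3 := by
    have h := (belowDiagram T i).rowLen_anti (i - (j + 1)) (i - j) (by lia)
    rw [if_pos (by lia), if_pos (by lia)]
    lia
  zeros i j h := if_neg h

theorem tableauTriangle_entry (T : SemistandardYoungTableau μ) {n i j : ℕ} (hj : 1 ≤ j)
    (hji : j ≤ i) (hi : i ≤ n) :
    (tableauTriangle T n).entry i j = (belowDiagram T i).rowLen (i - j) + (j : ℤ) :=
  if_pos ⟨hj, hji, hi⟩

theorem tableauTriangle_strictSoutheast (T : SemistandardYoungTableau μ) (n : ℕ) :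
    (tableauTriangle T n).StrictSoutheast := by
  intro i j h1 h2 h3
  have h := rowLen_belowDiagram_le_succ T i (i - j)
  rw [tableauTriangle_entry T h1 h2 (by lia), tableauTriangle_entry T (by lia) (by lia) h3,
    Nat.add_sub_add_right]
  lia

end BelowDiagram

/-- The bottom row of the monotone triangles that correspond to tableaux of shape `μ`. -/
def shapeRow (n : ℕ) (μ : YoungDiagram) (i : Fin n) : ℤ :=
  (μ.rowLen (i.rev : ℕ) : ℤ) + ((i : ℕ) + 1)

theorem strictMono_shapeRow (n : ℕ) (μ : YoungDiagram) : StrictMono (shapeRow n μ) := by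
  intro i j hij
  have hrowLen := μ.rowLen_anti _ _ (Fin.rev_le_rev.mpr hij.le)
  have : (i : ℕ) < j := hij
  rw [shapeRow, shapeRow]
  lia

theorem tableauTriangle_hasBottomRow {μ : YoungDiagram} {n : ℕ} {T : SemistandardYoungTableau μ}
    (hT : ∀ r c, (r, c) ∈ μ → T r c < n) :
    (tableauTriangle T n).HasBottomRow (shapeRow n μ) := by
  intro j
  rw [tableauTriangle_entry T (by lia) j.2 le_rfl, belowDiagram_eq_self hT, shapeRow, Fin.val_rev]
  push_cast
  rfl

namespace MonotoneTriangle

variable {n : ℕ} {μ : YoungDiagram} {t : MonotoneTriangle n}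

/-- The `r`-th part of the shape in row `i` of a triangle, `r` counting from `0`: this is
`a_{i, i - r} - (i - r)`, extended by `0` to `r ≥ i`. -/
def part (t : MonotoneTriangle n) (i r : ℕ) : ℤ :=
  if r < i then t.entry i (i - r) - ((i - r : ℕ) : ℤ) else 0

theorem part_of_lt (t : MonotoneTriangle n) {i r : ℕ} (h : r < i) :
    t.part i r = t.entry i (i - r) - ((i - r : ℕ) : ℤ) :=
  if_pos h

theorem part_of_le (t : MonotoneTriangle n) {i r : ℕ} (h : i ≤ r) : t.part i r = 0 :=
  if_neg h.not_gt

theorem ext_part {t' : MonotoneTriangle n} (h : ∀ i ≤ n, ∀ r, t.part i r = t'.part i r) :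
    t = t' := by
  ext i j
  by_cases hij : 1 ≤ j ∧ j ≤ i ∧ i ≤ n
  · have hpart := h i hij.2.2 (i - j)
    rw [t.part_of_lt (by lia), t'.part_of_lt (by lia), Nat.sub_sub_self hij.2.1] at hpart
    exact sub_left_injective hpart
  · rw [t.zeros i j hij, t'.zeros i j hij]

theorem part_tableauTriangle (T : SemistandardYoungTableau μ) {i : ℕ} (hi : i ≤ n) (r : ℕ) :
    (tableauTriangle T n).part i r = (belowDiagram T i).rowLen r := by
  obtain hr | hr := lt_or_ge r i
  · rw [part_of_lt _ hr, tableauTriangle_entry T (by lia) (by lia) hi, Nat.sub_sub_self hr.le,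
      add_sub_cancel_right]
  · rw [part_of_le _ hr, rowLen_belowDiagram_of_le T hr, Nat.cast_zero]

theorem part_bottom (hμ : μ.colLen 0 ≤ n) (ht : t.HasBottomRow (shapeRow n μ)) (r : ℕ) :
    t.part n r = μ.rowLen r := by
  obtain hr | hr := lt_or_ge r n
  · have h := ht (Fin.rev ⟨r, hr⟩)
    rw [shapeRow, Fin.rev_rev, Fin.val_rev, Nat.sub_add_eq, Nat.sub_add_cancel (by lia)] at h
    rw [part_of_lt t hr, h]
    lia
  · rw [part_of_le t hr, rowLen_eq_zero_of_colLen_le (hμ.trans hr), Nat.cast_zero]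

theorem part_succ_succ_le (t : MonotoneTriangle n) {i : ℕ} (hi : i + 1 ≤ n) (r : ℕ) :
    t.part (i + 1) (r + 1) ≤ t.part i r := by
  obtain hr | hr := lt_or_ge r i
  · rw [part_of_lt t hr, part_of_lt t (by lia), Nat.add_sub_add_right]
    exact sub_le_sub_right (t.northeast i (i - r) (by lia) (by lia) hi) _
  · rw [part_of_le t hr, part_of_le t (by lia)]

theorem part_nonneg (hμ : μ.colLen 0 ≤ n) (ht : t.HasBottomRow (shapeRow n μ)) {i : ℕ}
    (hi : i ≤ n) (r : ℕ) : 0 ≤ t.part i r := by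
  induction hi using Nat.decreasingInduction generalizing r with
  | of_succ i hi ih => exact (ih (r + 1)).trans (t.part_succ_succ_le hi r)
  | self => exact part_bottom hμ ht r ▸ Int.natCast_nonneg _

theorem part_le_succ (hμ : μ.colLen 0 ≤ n) (ht : t.HasBottomRow (shapeRow n μ))
    (hs : t.StrictSoutheast) {i : ℕ} (hi : i + 1 ≤ n) (r : ℕ) :
    t.part i r ≤ t.part (i + 1) r := by
  obtain hr | hr := lt_or_ge r i
  · have h := hs i (i - r) (by lia) (by lia) hi
    rw [part_of_lt t hr, part_of_lt t (by lia), Nat.sub_add_comm hr.le]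
    lia
  · exact t.part_of_le hr ▸ part_nonneg hμ ht hi r

theorem part_mono (hμ : μ.colLen 0 ≤ n) (ht : t.HasBottomRow (shapeRow n μ))
    (hs : t.StrictSoutheast) {i i' : ℕ} (hi : i ≤ i') (hi' : i' ≤ n) (r : ℕ) :
    t.part i r ≤ t.part i' r := by
  induction i', hi using Nat.le_induction with
  | base => exact le_rfl
  | succ i' _ ih => exact (ih (by lia)).trans (part_le_succ hμ ht hs hi' r)

theorem antitone_part (hμ : μ.colLen 0 ≤ n) (ht : t.HasBottomRow (shapeRow n μ))
    (hs : t.StrictSoutheast) {i : ℕ} (hi : i ≤ n) : Antitone (t.part i) := by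
  refine antitone_nat_of_succ_le fun r => ?_
  obtain hi | rfl := hi.lt_or_eq
  · exact (part_le_succ hμ ht hs hi _).trans (t.part_succ_succ_le hi r)
  · rw [part_bottom hμ ht, part_bottom hμ ht]
    exact_mod_cast μ.rowLen_anti _ _ r.le_succ

/-- The entry in row `r` and column `c` of the tableau of a triangle: the shape in row `m + 1` is
the first one that contains the cell `(r, c)` for `m` equal to this entry. -/
noncomputable def tableauEntry (t : MonotoneTriangle n) (r c : ℕ) : ℕ :=
  sInf {m : ℕ | (c : ℤ) < t.part (m + 1) r}

theorem lt_part_bottom (hμ : μ.colLen 0 ≤ n) (ht : t.HasBottomRow (shapeRow n μ)) {r c : ℕ}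
    (hc : (r, c) ∈ μ) : (c : ℤ) < t.part n r := by
  rw [part_bottom hμ ht]
  exact_mod_cast YoungDiagram.mem_iff_lt_rowLen.mp hc

theorem tableauEntry_lt_of_lt_part {r c i : ℕ} (h : (c : ℤ) < t.part i r) :
    t.tableauEntry r c < i := by
  cases i with
  | zero => exact absurd (t.part_of_le r.zero_le ▸ h) (Int.natCast_nonneg c).not_gt
  | succ m => exact Nat.lt_succ_of_le (Nat.sInf_le h)

theorem tableauEntry_lt_iff (hμ : μ.colLen 0 ≤ n) (ht : t.HasBottomRow (shapeRow n μ))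
    (hs : t.StrictSoutheast) {r c i : ℕ} (hc : (r, c) ∈ μ) (hi : i ≤ n) :
    t.tableauEntry r c < i ↔ (c : ℤ) < t.part i r := by
  refine ⟨fun h => ?_, tableauEntry_lt_of_lt_part⟩
  have hbottom := lt_part_bottom hμ ht hc
  obtain ⟨m, rfl⟩ := Nat.exists_eq_add_one_of_ne_zero (by lia : n ≠ 0)
  have hmem : t.tableauEntry r c ∈ {m : ℕ | (c : ℤ) < t.part (m + 1) r} :=
    Nat.sInf_mem ⟨m, hbottom⟩
  exact lt_of_lt_of_le hmem (part_mono hμ ht hs h hi r)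

theorem tableauEntry_lt (hμ : μ.colLen 0 ≤ n) (ht : t.HasBottomRow (shapeRow n μ)) {r c : ℕ}
    (hc : (r, c) ∈ μ) : t.tableauEntry r c < n :=
  tableauEntry_lt_of_lt_part (lt_part_bottom hμ ht hc)

open scoped Classical in
/-- The semistandard tableau of a monotone triangle that is strictly increasing in southeast
direction; this is the inverse of `tableauTriangle`. -/
noncomputable def tableau (hμ : μ.colLen 0 ≤ n) (ht : t.HasBottomRow (shapeRow n μ))
    (hs : t.StrictSoutheast) : SemistandardYoungTableau μ where
  entry r c := if (r, c) ∈ μ then t.tableauEntry r c else 0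
  row_weak' {r c₁ c₂} hc h2 := by
    have h1 : (r, c₁) ∈ μ := μ.up_left_mem le_rfl hc.le h2
    have hn := tableauEntry_lt hμ ht h2
    have hpart := (tableauEntry_lt_iff hμ ht hs h2 hn).mp (Nat.lt_succ_self _)
    rw [if_pos h1, if_pos h2, ← Nat.lt_succ_iff, tableauEntry_lt_iff hμ ht hs h1 hn]
    exact (Int.ofNat_lt.mpr hc).trans hpart
  col_strict' {r₁ r₂ c} hr h2 := by
    have h1 : (r₁, c) ∈ μ := μ.up_left_mem hr.le le_rfl h2
    have hn := tableauEntry_lt hμ ht h2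
    have hpart := (tableauEntry_lt_iff hμ ht hs h2 hn).mp (Nat.lt_succ_self _)
    rw [if_pos h1, if_pos h2, tableauEntry_lt_iff hμ ht hs h1 hn.le]
    calc (c : ℤ) < t.part (t.tableauEntry r₂ c + 1) r₂ := hpart
      _ ≤ t.part (t.tableauEntry r₂ c + 1) (r₁ + 1) := antitone_part hμ ht hs hn hr
      _ ≤ t.part (t.tableauEntry r₂ c) r₁ := t.part_succ_succ_le hn r₁
  zeros' h := if_neg h

theorem tableau_apply (hμ : μ.colLen 0 ≤ n) (ht : t.HasBottomRow (shapeRow n μ))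
    (hs : t.StrictSoutheast) {r c : ℕ} (hc : (r, c) ∈ μ) :
    tableau hμ ht hs r c = t.tableauEntry r c :=
  if_pos hc

theorem rowLen_belowDiagram_tableau (hμ : μ.colLen 0 ≤ n) (ht : t.HasBottomRow (shapeRow n μ))
    (hs : t.StrictSoutheast) {i : ℕ} (hi : i ≤ n) (r : ℕ) :
    ((belowDiagram (tableau hμ ht hs) i).rowLen r : ℤ) = t.part i r := by
  obtain ⟨p, hp⟩ := Int.eq_ofNat_of_zero_le (part_nonneg hμ ht hi r)
  have hpμ : p ≤ μ.rowLen r := by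
    have h := part_mono hμ ht hs hi le_rfl r
    rwa [part_bottom hμ ht, hp, Nat.cast_le] at h
  have hlt (c : ℕ) : c < (belowDiagram (tableau hμ ht hs) i).rowLen r ↔ c < p := by
    rw [← YoungDiagram.mem_iff_lt_rowLen, mem_belowDiagram, ← Int.ofNat_lt (n := c), ← hp]
    constructor
    · rintro ⟨hc, hci⟩
      rwa [tableau_apply hμ ht hs hc, tableauEntry_lt_iff hμ ht hs hc hi] at hci
    · intro hci
      have hc : (r, c) ∈ μ :=
        YoungDiagram.mem_iff_lt_rowLen.mpr (lt_of_lt_of_le (by lia) hpμ)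
      rw [tableau_apply hμ ht hs hc, tableauEntry_lt_iff hμ ht hs hc hi]
      exact ⟨hc, hci⟩
  rw [hp, Nat.cast_inj]
  exact eq_of_forall_lt_iff hlt

theorem tableauTriangle_tableau (hμ : μ.colLen 0 ≤ n) (ht : t.HasBottomRow (shapeRow n μ))
    (hs : t.StrictSoutheast) : tableauTriangle (tableau hμ ht hs) n = t :=
  ext_part fun i hi r => by
    rw [part_tableauTriangle _ hi, rowLen_belowDiagram_tableau hμ ht hs hi]

end MonotoneTriangle

open MonotoneTriangle in
theorem countSSYT_eq_countStrictMT (n : ℕ) (μ : YoungDiagram) (hμ : μ.colLen 0 ≤ n) :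
    countSSYT n μ = countStrictMT n (shapeRow n μ) := by
  refine Nat.card_eq_of_bijective (fun T => ⟨tableauTriangle T.1 n,
    tableauTriangle_hasBottomRow T.2, tableauTriangle_strictSoutheast T.1 n⟩) ⟨?_, ?_⟩
  · rintro ⟨T, hT⟩ ⟨T', hT'⟩ h
    refine Subtype.ext (tableau_ext_belowDiagram hT hT' fun i hi r => ?_)
    have hpart := congrArg (part · i r) (congrArg Subtype.val h)
    simpa only [part_tableauTriangle _ hi, Nat.cast_inj] using hpart
  · rintro ⟨t, ht, hs⟩
    refine ⟨⟨tableau hμ ht hs, fun r c hc => ?_⟩,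
      Subtype.ext (tableauTriangle_tableau hμ ht hs)⟩
    rw [tableau_apply hμ ht hs hc]
    exact tableauEntry_lt hμ ht hc

end MonTri

open MonTri in
theorem mainTheorem2 (n : ℕ) (hn : 1 ≤ n) :
    -- the inverses in the formula exist
    (∀ p q : Fin n, p < q → IsUnit (factor (p, q))) ∧
    -- the number of monotone triangles with bottom row `k`
    (∀ k : Fin n → ℤ, StrictMono k →
      (countMT n k : ℂ) = evalInt k (prodInvOp n (vandermonde n))) ∧
    -- the same formula for the extension `α(n; k)` to all integer tuples
    (∀ k : Fin n → ℤ, (alpha n k : ℂ) = evalInt k (prodInvOp n (vandermonde n))) ∧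
    -- the enumeration is a polynomial `P`, unique and equal to `α(n; k)` on all of `ℤⁿ`;
    -- `prodOp n P` is the Vandermonde product, and it counts the strict patterns
    (∃! P : MvPolynomial (Fin n) ℂ,
      ∀ k : Fin n → ℤ, StrictMono k → evalInt k P = (countMT n k : ℂ)) ∧
    (∀ P : MvPolynomial (Fin n) ℂ,
      (∀ k : Fin n → ℤ, StrictMono k → evalInt k P = (countMT n k : ℂ)) →
        (∀ k : Fin n → ℤ, evalInt k P = (alpha n k : ℂ)) ∧
        prodOp n P = vandermonde n ∧
        (∀ k : Fin n → ℤ, StrictMono k → evalInt k (prodOp n P) = (countStrictMT n k : ℂ)) ∧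
        (∀ (k : Fin n → ℤ) (μ : YoungDiagram), μ.colLen 0 ≤ n →
          (∀ i : Fin n, k i = (μ.rowLen (i.rev : ℕ) : ℤ) + ((i : ℕ) + 1)) →
            evalInt k (prodOp n P) = (countSSYT n μ : ℂ))) := by
  have hα (k : Fin n → ℤ) : (alpha n k : ℂ) = evalInt k (prodInvOp n (vandermonde n)) :=
    (evalInt_prodInvOp_vandermonde n k).symm
  have hMT (k : Fin n → ℤ) (hk : StrictMono k) :
      (countMT n k : ℂ) = evalInt k (prodInvOp n (vandermonde n)) := by
    rw [← hα, ← countMT_eq_alpha n k hk, Int.cast_natCast]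
  have huniq (P : MvPolynomial (Fin n) ℂ)
      (hP : ∀ k : Fin n → ℤ, StrictMono k → evalInt k P = (countMT n k : ℂ)) :
      P = prodInvOp n (vandermonde n) :=
    sub_eq_zero.mp (eq_zero_of_strictMono fun k hk => by
      rw [evalInt, map_sub]
      exact sub_eq_zero.mpr ((hP k hk).trans (hMT k hk)))
  have hstrict (k : Fin n → ℤ) (hk : StrictMono k) :
      evalInt k (vandermonde n) = (countStrictMT n k : ℂ) := by
    rw [evalInt_vandermonde, ← countStrictMT_eq_chooseDet n k hk, Int.cast_natCast]
  refine ⟨fun p q _ => isUnit_factor (p, q), hMT, hα,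
    ⟨_, fun k hk => (hMT k hk).symm, huniq⟩, fun P hP => ?_⟩
  obtain rfl := huniq P hP
  rw [prodOp_prodInvOp_apply]
  refine ⟨fun k => (hα k).symm, rfl, hstrict, fun k μ hμ hk => ?_⟩
  obtain rfl : k = shapeRow n μ := funext hk
  rw [hstrict _ (strictMono_shapeRow n μ), countSSYT_eq_countStrictMT n μ hμ]
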